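/- Let $\mathfrak g$ be a compact simple real Lie algebra, let $\mathfrak h=\bigoplus_\alpha\mathfrak h_\alpha$ be a reductive Lie algebra, where the $\mathfrak h_\alpha$ are finitely many simple ideals and one (possibly zero) abelian ideal, let $\iota:\mathfrak h\hookrightarrow\mathfrak g$ be an injective homomorphism, and let $k\ge 1$ be an integer. Conventions. On a compact simple Lie algebra, $(\cdot,\cdot)$ denotes the positive definite invariant metric (a negative multiple of the Killing form) normalised so that long roots have squared length $2$, and $v=1+\langle\rho,\theta^\vee\rangle$ is the dual Coxeter number. For a simple ideal $\mathfrak h_\alpha$, $(\cdot,\cdot)_\alpha$ is its normalised metric, $v^\alpha$ its dual Coxeter number, and the Dynkin index $I_\alpha$ is defined by $(\iota x,\iota y)_{\mathfrak g}=I_\alpha (x,y)_\alpha$. For the abelian ideal put $I_\alpha=1$, $v^\alpha=0$, $(x,y)_\alpha=(\iota x,\iota y)_{\mathfrak g}$. For a basis $(e_a)$ of $\mathfrak h_\alpha$ let $g^\alpha_{ab}$ be the inverse of the matrix $(e_a,e_b)_\alpha$; similarly $g^{\mathfrak g}_{ab}$ for a basis of $\mathfrak g$. Let $P_\alpha$ be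 the orthogonal projection of $\mathfrak g$ onto $\iota(\mathfrak h_\alpha)$, and $C_2^\alpha=-\sum_{a,b} g^\alpha_{ab}\,\mathrm{ad}_{\iota e_a}\mathrm{ad}_{\iota e_b}$ the second Casimir element acting on $\mathfrak g$. Let a level-$k$ current algebra of $\mathfrak g$ in its unitary vacuum representation be given: a complex inner product space $V$ (the finite-energy vectors), operators $J^x_n$ on $V$, real-linear in $x\in\mathfrak g$, for $n\in\mathbb Z$ (the Fourier modes of the currents $j^x$ on the compactified light ray), with $$[J^x_m,J^y_n]=i\,J^{[x,y]}_{m+n}+k\,m\,(x,y)_{\mathfrak g}\,\delta_{m+n,0},\qquad (J^x_n)^\dagger=J^x_{-n},$$ and a unit vector $\Omega$, cyclic for the $J^x_n$, with $J^x_n\Omega=0$ for $n\ge 0$. The Sugawara stress-energy tensors are the fields with modes $$\Theta^{\mathfrak g}_n=\frac{1}{2(k+v^{\mathfrak g})}\sum_{m\in\mathbb Z}\sum_{a,b}g^{\mathfrak g}_{ab}:\!J^{a}_mJ^{b}_{n-m}\!:\,,\qquad \Theta^\alpha_n=\frac{1}{2(I_\alpha k+v^\alpha)}\sum_{m\in\mathbb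 Z}\sum_{a,b}g^\alpha_{ab}:\!J^{\iota e_a}_mJ^{\iota e_b}_{n-m}\!:\,,$$ where $:\!J_mJ_l\!:$ is $J_mJ_l$ for $m<0$ and $J_lJ_m$ for $m\ge0$, and $\Theta^{\mathfrak h}:=\sum_\alpha\Theta^\alpha$. Then the weighted Casimir element $$\widetilde C_2^{\iota(\mathfrak h)}:=\sum_\alpha\frac{2I_\alpha k\,P_\alpha+C_2^\alpha}{2(I_\alpha k+v^\alpha)}$$ is a self-adjoint operator on $(\mathfrak g,(\cdot,\cdot)_{\mathfrak g})$ and satisfies $\widetilde C_2^{\iota(\mathfrak h)}\le 1$. Moreover $\widetilde C_2^{\iota(\mathfrak h)}=1$ if and only if $\iota(\mathfrak h)\subset\mathfrak g$ yields a conformal inclusion, i.e. $\Theta^{\mathfrak h}=\Theta^{\mathfrak g}$. -/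

import Mathlib

open scoped TensorProduct

noncomputable section

namespace CurrentAlgebra

/-! ### Root data and the normalised metric of a compact simple Lie algebra -/

section Normalisation

theorem nonempty_root_of_nontrivial (L : Type*) [LieRing L] [LieAlgebra ℂ L]
    [FiniteDimensional ℂ L] [LieAlgebra.IsKilling ℂ L] [Nontrivial L]
    (H : LieSubalgebra ℂ L) [H.IsCartanSubalgebra] : Nonempty H.root := by
  by_contra hne
  have h1 := LieAlgebra.IsKilling.span_weight_isNonZero_eq_top ℂ L H
  have h2 : {α : LieModule.Weight ℂ H L | α.IsNonZero} = ∅ := by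
    ext α
    simp only [Set.mem_ofPred_eq, Set.mem_empty_iff_false, iff_false]
    intro hα
    exact hne ⟨⟨α, by simpa using hα⟩⟩
  rw [h2, Set.image_empty, Submodule.span_empty] at h1
  have h3 : Subsingleton (Module.Dual ℂ H) := by
    rwa [← Submodule.subsingleton_iff ℂ, ← subsingleton_iff_bot_eq_top]
  have h4 : Subsingleton H := Module.subsingleton_dual_iff ℂ |>.mp h3
  have h5 : H = ⊥ := by
    rw [LieSubalgebra.eq_bot_iff]
    intro x hx
    exact congrArg Subtype.val (Subsingleton.elim (⟨x, hx⟩ : H) 0)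
  have h6 := LieSubalgebra.IsCartanSubalgebra.self_normalizing (H := H)
  obtain ⟨x, hx⟩ := exists_ne (0 : L)
  have : x ∈ H.normalizer := by
    rw [LieSubalgebra.mem_normalizer_iff]
    intro y hy
    rw [h5, LieSubalgebra.mem_bot] at hy
    simp [hy]
  rw [h6, h5, LieSubalgebra.mem_bot] at this
  exact hx this

variable (𝔨 : Type*) [LieRing 𝔨] [LieAlgebra ℝ 𝔨] [FiniteDimensional ℝ 𝔨]

/-- The complexification of a real Lie algebra. -/
abbrev Complexification : Type _ := ℂ ⊗[ℝ] 𝔨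

instance isKilling_complexification [LieAlgebra.IsSimple ℝ 𝔨] :
    LieAlgebra.IsKilling ℂ (Complexification 𝔨) := by
  have hK : (killingForm ℝ 𝔨).Nondegenerate := LieAlgebra.IsKilling.killingForm_nondegenerate ℝ 𝔨
  have hC : (killingForm ℂ (Complexification 𝔨)).Nondegenerate := by
    let b := Module.finBasis ℝ 𝔨
    let c := b.baseChange ℂ
    rw [LinearMap.BilinForm.nondegenerate_iff_det_ne_zero b] at hK
    rw [LinearMap.BilinForm.nondegenerate_iff_det_ne_zero c]
    have hm : LinearMap.BilinForm.toMatrix c (killingForm ℂ (Complexification 𝔨)) =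
        (LinearMap.BilinForm.toMatrix b (killingForm ℝ 𝔨)).map (algebraMap ℝ ℂ) := by
      ext i j
      simp only [LinearMap.BilinForm.toMatrix_apply, Matrix.map_apply, killingForm,
        LieModule.traceForm_baseChange, c, Module.Basis.baseChange_apply,
        LinearMap.BilinForm.baseChange_tmul]
      simp
    rw [hm, ← RingHom.mapMatrix_apply, ← RingHom.map_det]
    simpa using hK
  refine ⟨(LieSubmodule.eq_bot_iff _).mpr fun x hx => ?_⟩
  rw [LieIdeal.mem_killingCompl] at hx
  exact hC.2 x fun y => hx y trivial

/-- A Cartan subalgebra of the complexification (all of them are conjugate). -/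
def cartan : LieSubalgebra ℂ (Complexification 𝔨) :=
  LieSubalgebra.engel ℂ
    (LieAlgebra.exists_isCartanSubalgebra_engel ℂ (Complexification 𝔨)).choose

instance isCartanSubalgebra_cartan : (cartan 𝔨).IsCartanSubalgebra :=
  (LieAlgebra.exists_isCartanSubalgebra_engel ℂ (Complexification 𝔨)).choose_spec

variable [LieAlgebra.IsSimple ℝ 𝔨]

instance nonempty_root : Nonempty (cartan 𝔨).root := by
  have : Nontrivial 𝔨 := by
    by_contra h
    rw [not_nontrivial_iff_subsingleton] at h
    exact LieAlgebra.IsSimple.non_abelian (R := ℝ) (L := 𝔨) ⟨fun _ _ => Subsingleton.elim _ _⟩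
  have : Nontrivial (Complexification 𝔨) := inferInstance
  exact nonempty_root_of_nontrivial (Complexification 𝔨) (cartan 𝔨)

/-- The squared length of a root with respect to the (unnormalised) Killing form
`tr (ad x ∘ ad y)` of the complexification; it is a positive real number. -/
def rootSq (β : (cartan 𝔨).root) : ℝ :=
  ((β : LieModule.Weight ℂ (cartan 𝔨) (Complexification 𝔨))
    ((LieAlgebra.IsKilling.cartanEquivDual (cartan 𝔨)).symm
      (β : LieModule.Weight ℂ (cartan 𝔨) (Complexification 𝔨)).toLinear)).re

/-- A root of maximal length. -/
def longRoot : (cartan 𝔨).root := (Finite.exists_max (rootSq 𝔨)).choose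

/-- The dual Coxeter number `1 + ⟨ρ, θ^∨⟩`, where `θ` is the highest root and `ρ` is half the sum
of the positive roots. A long root `θ` is the highest root of a suitable positive system; there
`⟨β, θ^∨⟩ ≥ 0` for all positive `β`, so that the positive roots contribute
`⟨ρ, θ^∨⟩ = (1/2) ∑ max(0, ⟨β, θ^∨⟩)`, the sum running over all roots `β`. -/
def dualCoxeter : ℝ :=
  1 + (1 / 2) * ((∑ β : (cartan 𝔨).root,
    max 0 ((LieAlgebra.IsKilling.rootSystem (cartan 𝔨)).pairingIn ℤ β (longRoot 𝔨)) : ℤ) : ℝ)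

/-- The normalised invariant metric of a compact simple Lie algebra: the multiple of the Killing
form which is positive definite on the compact real form and for whose complex bilinear extension
(up to the sign, which reflects `T = i x` for hermitian generators `T`)
the long roots have squared length `2`. If `θ` has squared length `ℓ` for the Killing form `B`,
it has squared length `ℓ / c` for `c • B`, hence `c = ℓ / 2`. -/
def normForm : LinearMap.BilinForm ℝ 𝔨 :=
  (-(rootSq 𝔨 (longRoot 𝔨) / 2)) • killingForm ℝ 𝔨

end Normalisation

/-! ### Reductive Lie algebras -/

/-- A decomposition of a Lie algebra into the direct sum of finitely many simple ideals,
indexed by `σ`, and an abelian ideal (possibly zero). A finite-dimensional real Lie algebra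
is reductive if and only if it has such a decomposition. -/
structure ReductiveDecomposition (𝔥 : Type*) [LieRing 𝔥] [LieAlgebra ℝ 𝔥] (σ : Type*) where
  simple : σ → LieIdeal ℝ 𝔥
  abelian : LieIdeal ℝ 𝔥
  isSimple : ∀ a, LieAlgebra.IsSimple ℝ (simple a)
  isLieAbelian : IsLieAbelian abelian
  independent : iSupIndep fun α : Option σ => α.elim abelian simple
  iSup_eq_top : ⨆ α : Option σ, α.elim abelian simple = ⊤

/-- Contraction of a bilinear expression `Φ` in two vectors with the inverse of the metric `B`:
the sum of `g_{ab} Φ(T^a, T^b)` over a basis `T^a`, where `g_{ab}` is the inverse of the matrix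
`g^{ab} = B(T^a, T^b)`. It does not depend on the basis if `B` is nondegenerate. -/
def contract {E W : Type*} [AddCommGroup E] [Module ℝ E] [FiniteDimensional ℝ E]
    [AddCommMonoid W] [Module ℝ W] (B : LinearMap.BilinForm ℝ E) (Φ : E → E → W) : W :=
  let T := Module.finBasis ℝ E
  ∑ a, ∑ b, (LinearMap.BilinForm.toMatrix T B)⁻¹ a b • Φ (T a) (T b)

section Embedding

variable {𝔤 𝔥 σ : Type*} [LieRing 𝔤] [LieAlgebra ℝ 𝔤] [FiniteDimensional ℝ 𝔤]
  [LieAlgebra.IsSimple ℝ 𝔤] [LieRing 𝔥] [LieAlgebra ℝ 𝔥] [FiniteDimensional ℝ 𝔥]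
  (ι : 𝔥 →ₗ⁅ℝ⁆ 𝔤) (D : ReductiveDecomposition 𝔥 σ)

/-- The ideals `𝔥_α`: the abelian ideal for `none`, the simple ideals for `some a`. -/
def ReductiveDecomposition.ideal (α : Option σ) : LieIdeal ℝ 𝔥 := α.elim D.abelian D.simple

/-- The restriction of `ι` to `𝔥_α`, as a linear map. -/
def embed (α : Option σ) : D.ideal α →ₗ[ℝ] 𝔤 :=
  (ι : 𝔥 →ₗ[ℝ] 𝔤) ∘ₗ (D.ideal α).toSubmodule.subtype

/-- The metric `g_α`: the normalised metric of a simple ideal, and the restriction of the metric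
of `𝔤` to the abelian ideal. -/
def metric : (α : Option σ) → LinearMap.BilinForm ℝ (D.ideal α)
  | none => (normForm 𝔤).comp (embed ι D none) (embed ι D none)
  | some a => haveI := D.isSimple a; (normForm (D.simple a) : LinearMap.BilinForm ℝ (D.simple a))

/-- The Dynkin index `I_α`: the number with `(ι x, ι y)_𝔤 = I_α (x, y)_α` on a simple ideal, and
`1` for the abelian ideal. -/
def dynkinIndex : Option σ → ℝ
  | none => 1
  | some a => Classical.epsilon fun I : ℝ => ∀ x y : D.ideal (some a),
      normForm 𝔤 (embed ι D (some a) x) (embed ι D (some a) y) = I * metric ι D (some a) x y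

/-- The dual Coxeter number `v^α` of a simple ideal, and `0` for the abelian ideal. -/
def coxeter : Option σ → ℝ
  | none => 0
  | some a => haveI := D.isSimple a; dualCoxeter (D.simple a)

/-- The orthogonal projection `P_α` of `𝔤` onto `ι(𝔥_α)` with respect to the metric of `𝔤`. -/
def proj (α : Option σ) : Module.End ℝ 𝔤 :=
  contract ((normForm 𝔤).comp (embed ι D α) (embed ι D α)) fun a b =>
    (normForm 𝔤 (embed ι D α b)).smulRight (embed ι D α a)

/-- The second Casimir element `C₂^α` of `𝔥_α` acting on `𝔤` through the adjoint representation: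
`g_{ab} Ad(T^a) Ad(T^b)` for the hermitian generators `T = i x` with `x` in the real Lie algebra,
which accounts for the sign. -/
def casimir (α : Option σ) : Module.End ℝ 𝔤 :=
  contract (metric ι D α) fun a b =>
    -(LieAlgebra.ad ℝ 𝔤 (embed ι D α a) * LieAlgebra.ad ℝ 𝔤 (embed ι D α b))

/-- The weighted Casimir element at level `k`. -/
def weightedCasimir [Fintype σ] (k : ℕ) : Module.End ℝ 𝔤 :=
  ∑ α : Option σ, (1 / (2 * (dynkinIndex ι D α * k + coxeter D α))) •
    ((2 * dynkinIndex ι D α * k) • proj ι D α + casimir ι D α)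

end Embedding

/-! ### Current algebras and Sugawara tensors -/

section Currents

variable {𝔤 : Type*} [LieRing 𝔤] [LieAlgebra ℝ 𝔤] [FiniteDimensional ℝ 𝔤]
  [LieAlgebra.IsSimple ℝ 𝔤]

/-- The (unitary, positive energy) vacuum representation of the level-`k` current algebra of `𝔤`
on the space `V` of finite-energy vectors. `J x n` is the `n`-th Fourier mode of the current
`j^x`: in the coordinate `z = (1 + i t) / (1 - i t) = e^{iϑ}` of the compactified light ray one has
`j^x(t) dt = (2π)⁻¹ ∑ₙ (J x n) e^{-inϑ} dϑ`, and the relations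
`[j^x(s), j^y(t)] = i j^{[x,y]}(s) δ(s-t) + k (x,y) (i / 2π) δ'(s-t)`, `j^x(t)^† = j^x(t)`
become those below. -/
structure VacuumCurrents (𝔤 : Type*) [LieRing 𝔤] [LieAlgebra ℝ 𝔤] [FiniteDimensional ℝ 𝔤]
    [LieAlgebra.IsSimple ℝ 𝔤] (k : ℕ) (V : Type*) [NormedAddCommGroup V]
    [InnerProductSpace ℂ V] where
  /-- the modes of the currents -/
  J : 𝔤 →ₗ[ℝ] (ℤ → Module.End ℂ V)
  /-- the vacuum vector -/
  Ω : V
  norm_vacuum : ‖Ω‖ = 1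
  commutator : ∀ (x y : 𝔤) (m n : ℤ),
    J x m * J y n - J y n * J x m = Complex.I • J ⁅x, y⁆ (m + n) +
      (if m + n = 0 then ((k * m * normForm 𝔤 x y : ℝ) : ℂ) else 0) • (1 : Module.End ℂ V)
  hermitian : ∀ (x : 𝔤) (n : ℤ) (φ ψ : V), inner ℂ (J x n φ) ψ = inner ℂ φ (J x (-n) ψ)
  annihilation : ∀ (x : 𝔤) (n : ℤ), 0 ≤ n → J x n Ω = 0
  cyclic : ∀ W : Submodule ℂ V, Ω ∈ W → (∀ x n, ∀ φ ∈ W, J x n φ ∈ W) → W = ⊤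

variable {k : ℕ} {V : Type*} [NormedAddCommGroup V] [InnerProductSpace ℂ V]

/-- The normal ordered product `:(J x m) (J y n):`. -/
def normalOrder (A : VacuumCurrents 𝔤 k V) (x y : 𝔤) (m n : ℤ) : Module.End ℂ V :=
  if m < 0 then A.J x m * A.J y n else A.J y n * A.J x m

/-- The `n`-th mode of the field `(π / N) g_{ab} :j^{τ a} j^{τ b}:`, for colours in the range of
`τ` and the inverse `g_{ab}` of a metric `B`; in modes the prefactor is `1 / (2N)`. On every
finite-energy vector only finitely many terms of the sum over `m` are nonzero. A field is
identified with the family of its modes. -/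
def sugawara {E : Type*} [AddCommGroup E] [Module ℝ E] [FiniteDimensional ℝ E]
    (A : VacuumCurrents 𝔤 k V) (τ : E →ₗ[ℝ] 𝔤) (B : LinearMap.BilinForm ℝ E) (N : ℝ)
    (n : ℤ) (φ : V) : V :=
  (1 / (2 * N)) • ∑ᶠ m : ℤ, (contract B fun a b => normalOrder A (τ a) (τ b) m (n - m)) φ

/-- The Sugawara stress-energy tensor `Θ^𝔤`. -/
def stressG (A : VacuumCurrents 𝔤 k V) : ℤ → V → V :=
  sugawara A LinearMap.id (normForm 𝔤) (k + dualCoxeter 𝔤)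

variable {𝔥 σ : Type*} [LieRing 𝔥] [LieAlgebra ℝ 𝔥] [FiniteDimensional ℝ 𝔥]

/-- The stress-energy tensor `Θ^𝔥 = ∑_α Θ^α`. -/
def stressH [Fintype σ] (A : VacuumCurrents 𝔤 k V) (ι : 𝔥 →ₗ⁅ℝ⁆ 𝔤)
    (D : ReductiveDecomposition 𝔥 σ) : ℤ → V → V :=
  ∑ α : Option σ, sugawara A (embed ι D α) (metric ι D α) (dynkinIndex ι D α * k + coxeter D α)

end Currents

end CurrentAlgebra

end

open CurrentAlgebra

open scoped TensorProduct Matrix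

noncomputable section

namespace CurrentAlgebra

/-! ### Root lengths for the Killing form -/

section RootLengths

open LieAlgebra LieAlgebra.IsKilling LieModule

variable {L : Type*} [LieRing L] [LieAlgebra ℂ L] [FiniteDimensional ℂ L] [IsKilling ℂ L]
  {H : LieSubalgebra ℂ L} [H.IsCartanSubalgebra]

/-! Every field involved is quadratic in the currents: a tensor t in 𝔤 ⊗ 𝔤 defines normal ordered
modes Q_n(t) (`quad`), and both Sugawara tensors have this form. The argument rests on one
commutator (`J_quad`): [J^x_p, Q_n(t)] = i Q_{n+p}(x·t) + p J^{L_x t}_{n+p} + a scalar, where the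
scalar vanishes for inverse metrics because they are symmetric. The map x ↦ L_x t (`linearPart`) is
the identity for Θ^𝔤, because the Casimir element acts as 2v on the adjoint representation, and it
is the weighted Casimir C for Θ^𝔥. So if s and r are the tensors of Θ^𝔤 and Θ^𝔥, the coset tensor t
= s - r has L_x t = x - Cx, and Q_0(t) J^x_{-1}Ω = J^{x-Cx}_{-1}Ω: the operator 1 - C is the coset
energy on vectors of energy one.

Positivity (`linearPart_nonneg`): for φ = J^x_{-1}Ω and ψ = Q_{-1}(t)φ one finds ‖ψ‖² = 2k (x, L_x
t). This is the relation ‖L_{-1}φ‖² = 2⟨φ, L_0 φ⟩ of the coset Virasoro algebra, but it is reached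
without Virasoro relations or hermiticity of the Q_n: since the currents of 𝔥 commute with Q(t), ψ
is orthogonal to Q_{-1}(r)φ, while Q_{-1}(s)φ = J^x_{-2}Ω.

Equality (`quad_eq_zero_iff`): if L_x t = 0 for all x, commutators with currents only produce
further fields Q(x·t) of the same kind; these kill Ω by induction on the mode number, hence all of V
by cyclicity. Conversely, Q_0(t) = 0 forces J^{L_x t}_{-1}Ω = 0, hence L_x t = 0 since k > 0 and the
metric is definite. -/

theorem traceForm_eq_sum_root (x y : H) :
    traceForm ℂ H L x y = ∑ β : H.root, β.1 x * β.1 y := by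
  have h := congrArg (fun F : LinearMap.BilinForm ℂ H => F x y)
    (restrict_killingForm_eq_sum (K := ℂ) (L := L) (H := H))
  rw [restrict_killingForm] at h
  simp only [LinearMap.coe_sum, Finset.sum_apply, LinearMap.smulRight_apply, LinearMap.smul_apply,
    smul_eq_mul, Weight.toLinear_apply] at h
  rw [h, ← Finset.sum_coe_sort]

/-- The complex squared length of a root with respect to the Killing form. -/
def rootSqC (β : H.root) : ℂ := β.1 ((cartanEquivDual H).symm β.1.toLinear)

theorem rootSqC_ne_zero (β : H.root) : rootSqC β ≠ 0 :=
  root_apply_cartanEquivDual_symm_ne_zero (H.isNonZero_coe_root β)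

/-- Evaluate the Killing form on (α^∨, α^∨): as a sum over roots it is the sum of squared pairings,
and since α^∨ = 2 t_α / (α, α) it is 4 / (α, α). Absolute root lengths thus become a matter of
Cartan integers. -/
theorem rootSqC_mul_sum (α : H.root) :
    rootSqC α * ∑ β : H.root, ((rootSystem H).pairing β α) ^ 2 = 4 := by
  have h := traceForm_coroot α.1 (coroot α.1)
  rw [traceForm_eq_sum_root, root_apply_coroot (H.isNonZero_coe_root α)] at h
  simp only [rootSystem_pairing_apply, sq, h]
  have := rootSqC_ne_zero α
  rw [rootSqC] at this ⊢
  simp only [nsmul_eq_mul, smul_eq_mul]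
  field_simp
  norm_num

theorem apply_cartanEquivDual_symm_comm (α β : Weight ℂ H L) :
    β ((cartanEquivDual H).symm α.toLinear) = α ((cartanEquivDual H).symm β.toLinear) := by
  have h1 : cartanEquivDual H ((cartanEquivDual H).symm β.toLinear)
      ((cartanEquivDual H).symm α.toLinear) = β ((cartanEquivDual H).symm α.toLinear) := by
    rw [LinearEquiv.apply_symm_apply, Weight.toLinear_apply]
  have h2 : cartanEquivDual H ((cartanEquivDual H).symm α.toLinear)
      ((cartanEquivDual H).symm β.toLinear) = α ((cartanEquivDual H).symm β.toLinear) := by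
    rw [LinearEquiv.apply_symm_apply, Weight.toLinear_apply]
  rw [← h1, ← h2]
  exact traceForm_comm ℂ H L _ _

/-- Both sides are 2(α, β). -/
theorem pairing_mul_rootSqC (α β : H.root) :
    (rootSystem H).pairing β α * rootSqC α = (rootSystem H).pairing α β * rootSqC β := by
  have key : ∀ α β : H.root, (rootSystem H).pairing β α * rootSqC α =
      2 * β.1 ((cartanEquivDual H).symm α.1.toLinear) := by
    intro α β
    have := rootSqC_ne_zero α
    rw [rootSystem_pairing_apply, rootSqC] at *
    rw [coroot, ← Weight.toLinear_apply, map_nsmul, map_smul]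
    simp only [nsmul_eq_mul, smul_eq_mul, Weight.toLinear_apply]
    field_simp
    ring
  rw [key, key, apply_cartanEquivDual_symm_comm]

end RootLengths

/-! ### The dual Coxeter number and the length of a long root -/

section DualCoxeter

open LieAlgebra LieAlgebra.IsKilling LieModule

variable (𝔨 : Type*) [LieRing 𝔨] [LieAlgebra ℝ 𝔨] [FiniteDimensional ℝ 𝔨]
  [LieAlgebra.IsSimple ℝ 𝔨]

theorem rootSqC_eq (α : (cartan 𝔨).root) :
    rootSqC α = ((4 / ((∑ β : (cartan 𝔨).root,
      ((rootSystem (cartan 𝔨)).pairingIn ℤ β α) ^ 2 : ℤ) : ℝ) : ℝ) : ℂ) := by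
  have h := rootSqC_mul_sum α
  have hp : ∀ β, (rootSystem (cartan 𝔨)).pairing β α =
      (((rootSystem (cartan 𝔨)).pairingIn ℤ β α : ℤ) : ℂ) := fun β => by
    rw [← (rootSystem (cartan 𝔨)).algebraMap_pairingIn ℤ]; rfl
  simp only [hp] at h
  push_cast
  rw [eq_div_iff, h]
  intro h0
  rw [h0] at h
  simp at h

theorem coe_rootSq (α : (cartan 𝔨).root) : ((rootSq 𝔨 α : ℝ) : ℂ) = rootSqC α := by
  have : rootSq 𝔨 α = (rootSqC α).re := rfl
  rw [this, rootSqC_eq, Complex.ofReal_re]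

theorem rootSq_mul_sum (α : (cartan 𝔨).root) :
    rootSq 𝔨 α * ((∑ β : (cartan 𝔨).root,
      ((rootSystem (cartan 𝔨)).pairingIn ℤ β α) ^ 2 : ℤ) : ℝ) = 4 := by
  have h1 : rootSq 𝔨 α ≠ 0 := by
    intro h
    have := coe_rootSq 𝔨 α
    rw [h] at this
    exact rootSqC_ne_zero α this.symm
  have h2 : rootSq 𝔨 α = 4 / ((∑ β : (cartan 𝔨).root,
      ((rootSystem (cartan 𝔨)).pairingIn ℤ β α) ^ 2 : ℤ) : ℝ) := by
    have := coe_rootSq 𝔨 α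
    rw [rootSqC_eq] at this
    exact_mod_cast this
  rw [h2] at h1 ⊢
  apply div_mul_cancel₀
  intro h0
  rw [h0] at h1
  simp at h1

theorem rootSq_pos (α : (cartan 𝔨).root) : 0 < rootSq 𝔨 α := by
  have h := rootSq_mul_sum 𝔨 α
  by_contra hn
  have : (0 : ℝ) ≤ ((∑ β : (cartan 𝔨).root,
      ((rootSystem (cartan 𝔨)).pairingIn ℤ β α) ^ 2 : ℤ) : ℝ) := by
    exact Int.cast_nonneg (Finset.sum_nonneg fun β _ => sq_nonneg _)
  nlinarith

theorem pairingIn_mul_rootSq (α β : (cartan 𝔨).root) :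
    ((rootSystem (cartan 𝔨)).pairingIn ℤ β α : ℝ) * rootSq 𝔨 α =
      ((rootSystem (cartan 𝔨)).pairingIn ℤ α β : ℝ) * rootSq 𝔨 β := by
  have h := pairing_mul_rootSqC α β
  rw [← coe_rootSq, ← coe_rootSq, ← (rootSystem (cartan 𝔨)).algebraMap_pairingIn ℤ,
    ← (rootSystem (cartan 𝔨)).algebraMap_pairingIn ℤ] at h
  simp only [algebraMap_int_eq, eq_intCast] at h
  exact_mod_cast h

theorem rootSq_le_longRoot (α : (cartan 𝔨).root) : rootSq 𝔨 α ≤ rootSq 𝔨 (longRoot 𝔨) :=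
  (Finite.exists_max (rootSq 𝔨)).choose_spec α

/-- For non-proportional roots the pairs of Cartan integers come from a finite list; as θ is at
least as long as β, the entry ⟨β, θ^∨⟩ is the one of smaller absolute value, hence at most 1 in
absolute value. -/
theorem pairingIn_longRoot (β : (cartan 𝔨).root)
    (h1 : β ≠ longRoot 𝔨)
    (h2 : (rootSystem (cartan 𝔨)).root β ≠ -(rootSystem (cartan 𝔨)).root (longRoot 𝔨)) :
    (rootSystem (cartan 𝔨)).pairingIn ℤ β (longRoot 𝔨) = -1 ∨
    (rootSystem (cartan 𝔨)).pairingIn ℤ β (longRoot 𝔨) = 0 ∨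
    (rootSystem (cartan 𝔨)).pairingIn ℤ β (longRoot 𝔨) = 1 := by
  have h := (rootSystem (cartan 𝔨)).pairingIn_pairingIn_mem_set_of_isCrystal_of_isRed'
    β (longRoot 𝔨) (fun h => h1 ((rootSystem (cartan 𝔨)).root.injective h)) h2
  have hm := pairingIn_mul_rootSq 𝔨 (longRoot 𝔨) β
  have hle := rootSq_le_longRoot 𝔨 β
  have hpos := rootSq_pos 𝔨 β
  simp only [Set.mem_insert_iff, Set.mem_singleton_iff, Prod.mk.injEq] at h
  rcases h with h | h | h | h | h | h | h | h | h | h | h <;> rw [h.1, h.2] at hm <;>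
    simp only [h.1] <;> norm_num at hm ⊢ <;> linarith

/-- The reflection in θ negates f(β) = ⟨β, θ^∨⟩, so the sum of |f| is twice the sum of max(0, f).
Squares agree with absolute values except at ±θ, where 4 exceeds 2; these two roots give the extra 2
+ 2. -/
theorem sum_sq_pairingIn_longRoot :
    (∑ β : (cartan 𝔨).root, ((rootSystem (cartan 𝔨)).pairingIn ℤ β (longRoot 𝔨)) ^ 2) =
      4 + 2 * ∑ β : (cartan 𝔨).root,
        max 0 ((rootSystem (cartan 𝔨)).pairingIn ℤ β (longRoot 𝔨)) := by
  classical
  set P := rootSystem (cartan 𝔨)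
  set θ := longRoot 𝔨
  set f : (cartan 𝔨).root → ℤ := fun β => P.pairingIn ℤ β θ with hf
  let s : (cartan 𝔨).root ≃ (cartan 𝔨).root := P.reflectionPerm θ
  have hs : ∀ β, f (s β) = - f β := fun β => by
    simp only [hf, s]
    rw [← P.pairingIn_reflectionPerm, P.pairingIn_reflectionPerm_self_right]
  have hsθ : P.root (s θ) = -P.root θ := by simp [s, P.root_reflectionPerm]
  have hθ : f θ = 2 := by simp [hf]
  have hne : θ ≠ s θ := by
    intro h
    have h' := hs θ
    rw [← h, hθ] at h'
    norm_num at h'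
  have h1 : ∀ β, f β ^ 2 = max 0 (f β) + max 0 (f (s β)) +
      ((if β = θ then 2 else 0) + (if β = s θ then 2 else 0)) := by
    intro β
    rw [hs]
    by_cases e1 : β = θ
    · rw [e1, hθ, if_pos rfl, if_neg hne]; norm_num
    by_cases e2 : β = s θ
    · rw [e2, hs, hθ, if_pos rfl, if_neg hne.symm]; norm_num
    rw [if_neg e1, if_neg e2]
    rcases pairingIn_longRoot 𝔨 β e1
      (fun h => e2 (P.root.injective (h.trans hsθ.symm))) with h | h | h <;>
    · change f β = _ at h
      rw [h]; norm_num
  calc ∑ β, f β ^ 2 = ∑ β, (max 0 (f β) + max 0 (f (s β)) +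
      ((if β = θ then 2 else 0) + (if β = s θ then 2 else 0))) := Finset.sum_congr rfl fun β _ => h1 β
    _ = ∑ β, max 0 (f β) + ∑ β, max 0 (f (s β)) + (2 + 2) := by
      simp [Finset.sum_add_distrib]
    _ = _ := by
      rw [Equiv.sum_comp s fun β => max 0 (f β)]
      ring

/-- With S the sum of max(0, ⟨β, θ^∨⟩), the squared length of θ times 4 + 2S is 4, and v = 1 + S/2.
Consequently the Killing form is -2v times the normalised metric. -/
theorem dualCoxeter_mul_rootSq : dualCoxeter 𝔨 * rootSq 𝔨 (longRoot 𝔨) = 1 := by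
  have h := rootSq_mul_sum 𝔨 (longRoot 𝔨)
  rw [sum_sq_pairingIn_longRoot] at h
  rw [dualCoxeter]
  push_cast at h ⊢
  linarith

end DualCoxeter

/-! ### Metrics, orthonormal bases and contraction -/

section PositiveForms

open Module

variable {E : Type*} [AddCommGroup E] [Module ℝ E]

/-- A symmetric positive definite real bilinear form. -/
structure IsMetric (B : LinearMap.BilinForm ℝ E) : Prop where
  symm : ∀ x y, B x y = B y x
  pos : ∀ x, x ≠ 0 → 0 < B x x

/-- A family of vectors which is orthonormal for a bilinear form. -/
def IsOrthonormal {n : Type*} [DecidableEq n] (B : LinearMap.BilinForm ℝ E) (e : n → E) : Prop :=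
  ∀ i j, B (e i) (e j) = if i = j then 1 else 0

/-- The inner product space structure defined by a metric. -/
abbrev IsMetric.core {B : LinearMap.BilinForm ℝ E} (hB : IsMetric B) :
    InnerProductSpace.Core ℝ E where
  inner x y := B x y
  conj_inner_symm x y := hB.symm y x
  re_inner_nonneg x := by
    by_cases hx : x = 0
    · simp [hx]
    · exact (hB.pos x hx).le
  add_left x y z := by simp
  smul_left x y r := by simp
  definite x h := by
    by_contra hx
    exact (hB.pos x hx).ne' h

theorem IsOrthonormal.repr_eq {n : Type*} [Fintype n] [DecidableEq n]
    {B : LinearMap.BilinForm ℝ E} {e : Basis n ℝ E} (he : IsOrthonormal B e) (x : E) (i : n) :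
    e.repr x i = B (e i) x := by
  have h : B (e i) x = B (e i) (∑ j, e.repr x j • e j) := by rw [e.sum_repr]
  rw [h, map_sum]
  simp only [map_smul, he i _, smul_eq_mul, mul_ite, mul_one, mul_zero, Finset.sum_ite_eq,
    Finset.mem_univ, if_true]

theorem IsOrthonormal.sum_smul {n : Type*} [Fintype n] [DecidableEq n]
    {B : LinearMap.BilinForm ℝ E} {e : Basis n ℝ E} (he : IsOrthonormal B e) (x : E) :
    ∑ i, B (e i) x • e i = x := by
  simp only [← he.repr_eq, e.sum_repr]

theorem IsOrthonormal.trace_eq {n : Type*} [Fintype n] [DecidableEq n]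
    {B : LinearMap.BilinForm ℝ E} {e : Basis n ℝ E} (he : IsOrthonormal B e) (f : Module.End ℝ E) :
    LinearMap.trace ℝ E f = ∑ i, B (e i) (f (e i)) := by
  rw [LinearMap.trace_eq_matrix_trace ℝ e, Matrix.trace]
  refine Finset.sum_congr rfl fun i _ => ?_
  rw [Matrix.diag_apply, LinearMap.toMatrix_apply, he.repr_eq]

/-- The inverse of a metric is invariant under skew-symmetric endomorphisms. -/
theorem IsOrthonormal.sum_skew {n W : Type*} [Fintype n] [DecidableEq n] [AddCommGroup W]
    [Module ℝ W] {B : LinearMap.BilinForm ℝ E} {e : Basis n ℝ E} (he : IsOrthonormal B e)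
    (hB : IsMetric B) (d : Module.End ℝ E) (hd : ∀ x y, B (d x) y = -B x (d y))
    (Φ : E →ₗ[ℝ] E →ₗ[ℝ] W) : ∑ i, (Φ (d (e i)) (e i) + Φ (e i) (d (e i))) = 0 := by
  have h1 : ∀ i, Φ (d (e i)) (e i) = ∑ j, B (e j) (d (e i)) • Φ (e j) (e i) := fun i => by
    conv_lhs => rw [← he.sum_smul (d (e i))]
    simp only [map_sum, map_smul, LinearMap.sum_apply, LinearMap.smul_apply]
  have h2 : ∀ i, Φ (e i) (d (e i)) = ∑ j, B (e j) (d (e i)) • Φ (e i) (e j) := fun i => by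
    conv_lhs => rw [← he.sum_smul (d (e i))]
    simp only [map_sum, map_smul]
  rw [Finset.sum_add_distrib]
  simp only [h1, h2]
  rw [Finset.sum_comm, ← Finset.sum_add_distrib]
  refine Finset.sum_eq_zero fun i _ => ?_
  rw [← Finset.sum_add_distrib]
  refine Finset.sum_eq_zero fun j _ => ?_
  rw [hB.symm (e j) (d (e i)), hd, ← add_smul, add_neg_cancel, zero_smul]

variable [FiniteDimensional ℝ E]

theorem IsMetric.exists_orthonormal {B : LinearMap.BilinForm ℝ E} (hB : IsMetric B) :
    ∃ e : Basis (Fin (finrank ℝ E)) ℝ E, IsOrthonormal B e := by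
  let : NormedAddCommGroup E := hB.core.toNormedAddCommGroup
  let : InnerProductSpace ℝ E := InnerProductSpace.ofCore hB.core.toCore
  refine ⟨(stdOrthonormalBasis ℝ E).toBasis, fun i j => ?_⟩
  have h := orthonormal_iff_ite.mp (stdOrthonormalBasis ℝ E).orthonormal i j
  rw [OrthonormalBasis.coe_toBasis]
  exact h

/-- The operator T representing S with respect to B is self-adjoint, so the spectral theorem
applies. -/
theorem IsMetric.exists_eigenvector [Nontrivial E] {B S : LinearMap.BilinForm ℝ E}
    (hB : IsMetric B) (hS : ∀ x y, S x y = S y x) :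
    ∃ (c : ℝ) (x : E), x ≠ 0 ∧ ∀ y, S x y = c * B x y := by
  let : NormedAddCommGroup E := hB.core.toNormedAddCommGroup
  let : InnerProductSpace ℝ E := InnerProductSpace.ofCore hB.core.toCore
  obtain ⟨e, he⟩ := hB.exists_orthonormal
  let T : E →ₗ[ℝ] E := ∑ i, (S (e i)).smulRight (e i)
  have hT : ∀ x y : E, B (T x) y = S x y := by
    intro x y
    conv_rhs => rw [← he.sum_smul y]
    simp only [T, LinearMap.sum_apply, LinearMap.smulRight_apply, map_sum, map_smul,
      LinearMap.smul_apply, smul_eq_mul]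
    refine Finset.sum_congr rfl fun i _ => ?_
    rw [hS x, mul_comm]
  have hsym : T.IsSymmetric := fun x y => by
    change B (T x) y = B x (T y)
    rw [hT, hB.symm, hT, hS]
  obtain ⟨x, hx⟩ := (hsym.hasEigenvalue_iSup_of_finiteDimensional).exists_hasEigenvector
  set c : ℝ := ⨆ x : { x : E // x ≠ 0 }, RCLike.re (inner ℝ (T x) (x : E)) / ‖(x : E)‖ ^ 2
  refine ⟨c, x, hx.2, fun y => ?_⟩
  have hTx : T x = c • x := hx.apply_eq_smul
  rw [← hT, hTx, map_smul, LinearMap.smul_apply, smul_eq_mul]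

/-- The Gram matrix in the chosen basis is c PᵀP with P the change of basis, so its inverse is c⁻¹
QQᵀ with Q = P⁻¹, and Q carries the chosen basis to e. A general c is needed for `proj`, which
contracts with I_α times the metric of the summand. -/
theorem contract_eq_inv_smul_sum {n W : Type*} [Fintype n] [DecidableEq n] [AddCommGroup W]
    [Module ℝ W] {B : LinearMap.BilinForm ℝ E} {e : Basis n ℝ E} {c : ℝ} (hc : c ≠ 0)
    (he : ∀ i j, B (e i) (e j) = if i = j then c else 0) (Φ : E →ₗ[ℝ] E →ₗ[ℝ] W) :
    contract B (fun x y => Φ x y) = c⁻¹ • ∑ i, Φ (e i) (e i) := by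
  classical
  set T := Module.finBasis ℝ E with hT
  have h1 : LinearMap.BilinForm.toMatrix e B = c • (1 : Matrix n n ℝ) := by
    ext i j
    rw [LinearMap.BilinForm.toMatrix_apply, he i j, Matrix.smul_apply, Matrix.one_apply]
    simp
  have h2 : c • ((e.toMatrix T)ᵀ * e.toMatrix T) = LinearMap.BilinForm.toMatrix T B := by
    rw [← LinearMap.BilinForm.toMatrix_mul_basis_toMatrix e T B, h1, Matrix.mul_smul,
      Matrix.mul_one, Matrix.smul_mul]
  have h3 : (LinearMap.BilinForm.toMatrix T B)⁻¹ = c⁻¹ • (T.toMatrix e * (T.toMatrix e)ᵀ) := by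
    refine Matrix.inv_eq_right_inv ?_
    rw [← h2, Matrix.mul_smul, Matrix.smul_mul, smul_smul, inv_mul_cancel₀ hc, one_smul,
      Matrix.mul_assoc, ← Matrix.mul_assoc (e.toMatrix T), e.toMatrix_mul_toMatrix_flip,
      Matrix.one_mul, ← Matrix.transpose_mul, T.toMatrix_mul_toMatrix_flip, Matrix.transpose_one]
  have h4 : ∀ i, e i = ∑ a, T.toMatrix e a i • T a := fun i => by
    simp [Basis.toMatrix_apply, T.sum_repr]
  have h5 : ∀ i, Φ (e i) (e i) =
      ∑ a, ∑ b, (T.toMatrix e a i * T.toMatrix e b i) • Φ (T a) (T b) := fun i => by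
    conv_lhs => rw [h4 i]
    simp only [map_sum, map_smul, LinearMap.sum_apply, LinearMap.smul_apply, Finset.smul_sum,
      smul_smul]
    rw [Finset.sum_comm]
    refine Finset.sum_congr rfl fun a _ => Finset.sum_congr rfl fun b _ => ?_
    rw [mul_comm]
  simp only [contract]
  rw [← hT, h3]
  simp only [h5, Matrix.smul_apply, smul_assoc, Matrix.mul_apply, Matrix.transpose_apply,
    Finset.sum_smul, ← Finset.smul_sum]
  rw [Finset.sum_comm (s := (Finset.univ : Finset n))]
  exact congrArg _ (Finset.sum_congr rfl fun a _ => Finset.sum_comm)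

theorem contract_eq_sum {n W : Type*} [Fintype n] [DecidableEq n] [AddCommGroup W] [Module ℝ W]
    {B : LinearMap.BilinForm ℝ E} {e : Basis n ℝ E} (he : IsOrthonormal B e)
    (Φ : E →ₗ[ℝ] E →ₗ[ℝ] W) : contract B (fun x y => Φ x y) = ∑ i, Φ (e i) (e i) := by
  rw [contract_eq_inv_smul_sum one_ne_zero he, inv_one, one_smul]

theorem map_contract {W W' : Type*} [AddCommGroup W] [Module ℝ W] [AddCommGroup W'] [Module ℝ W']
    (B : LinearMap.BilinForm ℝ E) (f : W →ₗ[ℝ] W') (Φ : E → E → W) :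
    f (contract B Φ) = contract B fun x y => f (Φ x y) := by
  simp only [contract, map_sum, map_smul]

end PositiveForms

/-! ### Invariant forms and the Casimir eigenvalue of a compact simple algebra -/

section CompactSimple

open LieAlgebra LieModule

variable (L : Type*) [LieRing L] [LieAlgebra ℝ L]

theorem killingForm_lie_left (x y z : L) :
    killingForm ℝ L ⁅x, y⁆ z = - killingForm ℝ L y ⁅x, z⁆ := by
  rw [← lie_skew, map_neg, LinearMap.neg_apply]
  exact congrArg _ (traceForm_apply_lie_apply ℝ L L y x z)

variable [FiniteDimensional ℝ L] [IsSimple ℝ L]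

theorem normForm_lie_left (x y z : L) : normForm L ⁅x, y⁆ z = - normForm L y ⁅x, z⁆ := by
  simp only [normForm, LinearMap.smul_apply, killingForm_lie_left, smul_neg]

theorem isMetric_normForm (h : ∀ x : L, x ≠ 0 → killingForm ℝ L x x < 0) :
    IsMetric (normForm L) where
  symm x y := by
    simp only [normForm, LinearMap.smul_apply]
    rw [killingForm, traceForm_comm]
  pos x hx := by
    simp only [normForm, LinearMap.smul_apply, smul_eq_mul]
    exact mul_pos_of_neg_of_neg (by linarith [rootSq_pos L (longRoot L)]) (h x hx)

theorem dualCoxeter_pos : 0 < dualCoxeter L :=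
  pos_of_mul_pos_left (by rw [dualCoxeter_mul_rootSq]; exact one_pos)
    (rootSq_pos L (longRoot L)).le

/-- The second Casimir element of a compact simple Lie algebra acts as twice the dual Coxeter
number on the adjoint representation. -/
theorem sum_lie_lie_orthonormal (h : ∀ x : L, x ≠ 0 → killingForm ℝ L x x < 0)
    {n : Type*} [Fintype n] [DecidableEq n] {e : Module.Basis n ℝ L}
    (he : IsOrthonormal (normForm L) e) (x : L) :
    ∑ i, ⁅e i, ⁅e i, x⁆⁆ = -(2 * dualCoxeter L) • x := by
  have hm := isMetric_normForm L h
  -- By skewness of ad, both sides are -∑ ([e_i, x], [e_i, y]), the right one being the trace of ad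
  -- x ad y in the basis e.
  have key : ∀ y, normForm L (∑ i, ⁅e i, ⁅e i, x⁆⁆) y = killingForm ℝ L x y := by
    intro y
    have h1 : killingForm ℝ L x y = LinearMap.trace ℝ L (ad ℝ L x ∘ₗ ad ℝ L y) := rfl
    rw [h1, he.trace_eq, map_sum, LinearMap.sum_apply]
    refine Finset.sum_congr rfl fun i _ => ?_
    have h2 : normForm L (e i) ⁅x, ⁅y, e i⁆⁆ = -normForm L ⁅x, e i⁆ ⁅y, e i⁆ := by
      rw [normForm_lie_left, hm.symm, neg_neg, hm.symm]
    rw [normForm_lie_left, LinearMap.comp_apply, ad_apply, ad_apply, h2, ← lie_skew x (e i),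
      ← lie_skew y (e i)]
    simp only [map_neg, LinearMap.neg_apply, neg_neg]
  have hk : ∀ y, killingForm ℝ L x y = -(2 * dualCoxeter L) * normForm L x y := by
    intro y
    have := dualCoxeter_mul_rootSq L
    simp only [normForm, LinearMap.smul_apply, smul_eq_mul]
    linear_combination (-killingForm ℝ L x y) * this
  have h0 : ∀ y, normForm L (∑ i, ⁅e i, ⁅e i, x⁆⁆ - -(2 * dualCoxeter L) • x) y = 0 := by
    intro y
    rw [map_sub, LinearMap.sub_apply, key, hk, map_smul, LinearMap.smul_apply, smul_eq_mul, sub_self]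
  by_contra hne
  exact (hm.pos _ (sub_ne_zero.mpr hne)).ne.symm (h0 _)

/-- A simple Lie algebra with an invariant metric is compact. -/
theorem killingForm_neg_of_invariant {S : LinearMap.BilinForm ℝ L} (hS : IsMetric S)
    (hSi : ∀ x y z : L, S ⁅x, y⁆ z = - S y ⁅x, z⁆) (x : L) (hx : x ≠ 0) :
    killingForm ℝ L x x < 0 := by
  obtain ⟨e, he⟩ := hS.exists_orthonormal
  have h1 : killingForm ℝ L x x = LinearMap.trace ℝ L (ad ℝ L x ∘ₗ ad ℝ L x) := rfl
  have h2 : ∀ i, S (e i) ((ad ℝ L x ∘ₗ ad ℝ L x) (e i)) = -S ⁅x, e i⁆ ⁅x, e i⁆ := fun i => by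
    rw [LinearMap.comp_apply, ad_apply, ad_apply, hSi, neg_neg]
  rw [h1, he.trace_eq]
  simp only [h2]
  rw [Finset.sum_neg_distrib, neg_lt_zero]
  -- Otherwise x would lie in the centre, which is zero.
  have h3 : ∃ i, ⁅x, e i⁆ ≠ 0 := by
    by_contra! hn
    refine hx ?_
    have h4 : ad ℝ L x = 0 := e.ext fun i => by rw [ad_apply, hn i, LinearMap.zero_apply]
    have h5 : x ∈ center ℝ L := (mem_maxTrivSubmodule ℝ L L x).mpr fun y => by
      rw [← lie_skew, ← ad_apply (R := ℝ), h4, LinearMap.zero_apply, neg_zero]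
    rwa [center_eq_bot, LieSubmodule.mem_bot] at h5
  obtain ⟨i, hi⟩ := h3
  refine Finset.sum_pos' (fun j _ => ?_) ⟨i, Finset.mem_univ i, hS.pos _ hi⟩
  by_cases hj : ⁅x, e j⁆ = 0
  · rw [hj, map_zero]
  · exact (hS.pos _ hj).le

/-- Invariant symmetric bilinear forms on a compact simple Lie algebra are proportional. -/
theorem exists_eq_mul_of_invariant {B S : LinearMap.BilinForm ℝ L} (hB : IsMetric B)
    (hBi : ∀ x y z : L, B ⁅x, y⁆ z = - B y ⁅x, z⁆) (hS : ∀ x y, S x y = S y x)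
    (hSi : ∀ x y z : L, S ⁅x, y⁆ z = - S y ⁅x, z⁆) : ∃ c : ℝ, ∀ x y, S x y = c * B x y := by
  have : Nontrivial L := IsSimple.nontrivial ℝ L
  obtain ⟨c, x₀, hx₀, hc⟩ := hB.exists_eigenvector hS
  -- Invariance of both forms makes the eigenspace an ideal; it contains x₀, so by simplicity it is
  -- everything.
  let I : LieIdeal ℝ L :=
    { carrier := {x | ∀ y, S x y = c * B x y}
      add_mem' := fun {a b} ha hb y => by
        rw [map_add, map_add, LinearMap.add_apply, LinearMap.add_apply, ha y, hb y, mul_add]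
      zero_mem' := fun y => by simp
      smul_mem' := fun r a ha y => by
        rw [map_smul, map_smul, LinearMap.smul_apply, LinearMap.smul_apply, ha y, smul_eq_mul,
          smul_eq_mul]
        ring
      lie_mem := fun {x m} hm y => by
        rw [hSi, hBi, hm]
        ring }
  have hI : I = ⊤ := by
    rcases IsSimple.eq_bot_or_eq_top I with h | h
    · exact absurd ((LieSubmodule.mem_bot x₀).mp (h ▸ (show x₀ ∈ I from hc))) hx₀
    · exact h
  exact ⟨c, fun x y => (hI ▸ LieSubmodule.mem_top x : x ∈ I) y⟩

end CompactSimple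

/-! ### Current modes on the vacuum representation -/

section Modes

variable {𝔤 : Type*} [LieRing 𝔤] [LieAlgebra ℝ 𝔤] [FiniteDimensional ℝ 𝔤]
  [LieAlgebra.IsSimple ℝ 𝔤] {k : ℕ} {V : Type*} [NormedAddCommGroup V] [InnerProductSpace ℂ V]
  (A : VacuumCurrents 𝔤 k V)

namespace VacuumCurrents

theorem J_add (x y : 𝔤) (n : ℤ) : A.J (x + y) n = A.J x n + A.J y n := by
  rw [map_add, Pi.add_apply]

theorem J_smul (r : ℝ) (x : 𝔤) (n : ℤ) : A.J (r • x) n = r • A.J x n := by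
  rw [map_smul, Pi.smul_apply]

theorem J_zero (n : ℤ) : A.J 0 n = 0 := by
  rw [map_zero, Pi.zero_apply]

/-- The central term of the commutator of two modes. -/
def central (k : ℕ) (x y : 𝔤) (m n : ℤ) : ℂ :=
  if m + n = 0 then ((k * m * normForm 𝔤 x y : ℝ) : ℂ) else 0

theorem J_J (x y : 𝔤) (m n : ℤ) (φ : V) :
    A.J x m (A.J y n φ) = A.J y n (A.J x m φ) + Complex.I • A.J ⁅x, y⁆ (m + n) φ +
      central k x y m n • φ := by
  have h := congrArg (fun F : Module.End ℂ V => F φ) (A.commutator x y m n)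
  simp only [LinearMap.sub_apply, Module.End.mul_apply, LinearMap.add_apply, LinearMap.smul_apply,
    Module.End.one_apply] at h
  rw [sub_eq_iff_eq_add] at h
  rw [h, central]
  abel

theorem exists_forall_J_eq_zero (φ : V) : ∃ N : ℤ, ∀ m, N ≤ m → ∀ x, A.J x m φ = 0 := by
  let W : Submodule ℂ V :=
    { carrier := {φ | ∃ N : ℤ, ∀ m, N ≤ m → ∀ x, A.J x m φ = 0}
      add_mem' := by
        rintro a b ⟨N, hN⟩ ⟨M, hM⟩
        refine ⟨max N M, fun m hm x => ?_⟩
        rw [map_add, hN m (le_of_max_le_left hm), hM m (le_of_max_le_right hm), add_zero]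
      zero_mem' := ⟨0, fun m _ x => map_zero _⟩
      smul_mem' := by
        rintro c a ⟨N, hN⟩
        exact ⟨N, fun m hm x => by rw [map_smul, hN m hm, smul_zero]⟩ }
  have hW : W = ⊤ := by
    refine A.cyclic W ⟨0, fun m hm x => A.annihilation x m hm⟩ ?_
    rintro y n φ ⟨N, hN⟩
    -- The bound N - n handles the mode m + n of the commutator; 1 - n excludes m + n = 0 and with
    -- it the central term.
    refine ⟨max N (max (N - n) (1 - n)), fun m hm x => ?_⟩
    have h1 : N ≤ m := le_of_max_le_left hm
    have h2 := le_of_max_le_right hm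
    have h3 : N - n ≤ m := le_of_max_le_left h2
    have h4 : 1 - n ≤ m := le_of_max_le_right h2
    rw [J_J, hN m h1, hN (m + n) (by omega), central, if_neg (by omega)]
    simp
  exact (hW ▸ Submodule.mem_top : φ ∈ W)

/-- A subspace which contains the vacuum and is stable under the creation operators is everything. -/
theorem eq_top_of_creation (W : Submodule ℂ V) (hΩ : A.Ω ∈ W)
    (hW : ∀ x n, n < 0 → ∀ φ ∈ W, A.J x n φ ∈ W) : W = ⊤ := by
  let S : Submodule ℂ V :=
    sInf {W | A.Ω ∈ W ∧ ∀ x n, n < 0 → ∀ φ ∈ W, A.J x n φ ∈ W}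
  have hSΩ : A.Ω ∈ S := by
    rw [Submodule.mem_sInf]; exact fun W hW => hW.1
  have hSJ : ∀ x n, n < 0 → ∀ φ ∈ S, A.J x n φ ∈ S := by
    intro x n hn φ hφ
    rw [Submodule.mem_sInf] at hφ ⊢
    exact fun W hW => hW.2 x n hn φ (hφ W hW)
  -- S is the smallest subspace with the hypotheses. The vectors of S that every mode sends into S
  -- also form such a subspace, so S is stable under all modes and cyclicity applies.
  let S' : Submodule ℂ V :=
    { carrier := {φ | φ ∈ S ∧ ∀ x n, A.J x n φ ∈ S}
      add_mem' := fun {a b} ha hb => ⟨S.add_mem ha.1 hb.1, fun x n => by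
        rw [map_add]; exact S.add_mem (ha.2 x n) (hb.2 x n)⟩
      zero_mem' := ⟨S.zero_mem, fun x n => by rw [map_zero]; exact S.zero_mem⟩
      smul_mem' := fun c a ha => ⟨S.smul_mem c ha.1, fun x n => by
        rw [map_smul]; exact S.smul_mem c (ha.2 x n)⟩ }
  have hSS' : S ≤ S' := by
    refine sInf_le ⟨⟨hSΩ, fun x n => ?_⟩, ?_⟩
    · by_cases hn : n < 0
      · exact hSJ x n hn _ hSΩ
      · rw [A.annihilation x n (not_lt.mp hn)]; exact S.zero_mem
    · rintro x n hn φ ⟨h1, h2⟩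
      refine ⟨h2 x n, fun y m => ?_⟩
      rw [J_J]
      exact S.add_mem (S.add_mem (hSJ x n hn _ (h2 y m)) (S.smul_mem _ (h2 _ _))) (S.smul_mem _ h1)
  have hS : S = ⊤ := A.cyclic S hSΩ fun x n φ hφ => (hSS' hφ).2 x n
  exact top_le_iff.mp (hS ▸ sInf_le ⟨hΩ, hW⟩)

/-- A vector orthogonal to the vacuum which is killed by the annihilation operators vanishes. -/
theorem eq_zero_of_annihilated {ψ : V} (hΩ : inner ℂ ψ A.Ω = 0)
    (h : ∀ x n, 0 < n → A.J x n ψ = 0) : ψ = 0 := by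
  have htop : (ℂ ∙ ψ)ᗮ = ⊤ := by
    refine A.eq_top_of_creation _ (Submodule.mem_orthogonal_singleton_iff_inner_right.mpr hΩ) ?_
    intro x n hn φ _
    rw [Submodule.mem_orthogonal_singleton_iff_inner_right]
    have := A.hermitian x (-n) ψ φ
    rw [neg_neg] at this
    rw [← this, h x (-n) (by omega), inner_zero_left]
  have : ψ ∈ (ℂ ∙ ψ)ᗮ := htop ▸ Submodule.mem_top
  exact inner_self_eq_zero.mp (Submodule.mem_orthogonal_singleton_iff_inner_right.mp this)

theorem J_creation_vacuum (x y : 𝔤) (n : ℤ) (hn : 0 < n) :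
    A.J x n (A.J y (-1) A.Ω) = central k x y n (-1) • A.Ω := by
  rw [J_J, A.annihilation x n hn.le, A.annihilation _ (n + -1) (by omega)]
  simp

theorem J_one_creation_vacuum (x y : 𝔤) :
    A.J x 1 (A.J y (-1) A.Ω) = ((k * normForm 𝔤 x y : ℝ) : ℂ) • A.Ω := by
  rw [J_creation_vacuum _ _ _ _ one_pos, central, if_pos (by norm_num)]
  simp

/-- J^x_1 returns J^x_{-1}Ω to k (x, x) Ω, which is nonzero for x ≠ 0. -/
theorem eq_zero_of_creation_vacuum (hk : 0 < k) (hm : IsMetric (normForm 𝔤)) {x : 𝔤}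
    (h : A.J x (-1) A.Ω = 0) : x = 0 := by
  by_contra hx
  have h1 := A.J_one_creation_vacuum x x
  rw [h, map_zero] at h1
  have hΩ : A.Ω ≠ 0 := by
    intro h0
    have := A.norm_vacuum
    rw [h0, norm_zero] at this
    exact zero_ne_one this
  have h2 := (smul_eq_zero.mp h1.symm).resolve_right hΩ
  have h3 : (k : ℝ) * normForm 𝔤 x x = 0 := by exact_mod_cast h2
  have : (0 : ℝ) < k := by exact_mod_cast hk
  exact (mul_pos this (hm.pos x hx)).ne.symm h3

/-! ### Quadratic fields -/

/-- The `m`-th term of the `n`-th mode of the normal ordered quadratic field defined by a tensor. -/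
def quadTerm (n m : ℤ) : 𝔤 ⊗[ℝ] 𝔤 →ₗ[ℝ] Module.End ℂ V :=
  TensorProduct.lift (LinearMap.mk₂ ℝ (fun x y => normalOrder A x y m (n - m))
    (fun x x' y => by simp only [normalOrder, J_add]; split_ifs <;> simp [add_mul, mul_add])
    (fun c x y => by simp only [normalOrder, J_smul]; split_ifs <;> simp)
    (fun x y y' => by simp only [normalOrder, J_add]; split_ifs <;> simp [add_mul, mul_add])
    (fun c x y => by simp only [normalOrder, J_smul]; split_ifs <;> simp))

theorem quadTerm_tmul (n m : ℤ) (x y : 𝔤) :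
    A.quadTerm n m (x ⊗ₜ y) = normalOrder A x y m (n - m) := rfl

theorem quadTerm_tmul_apply (n m : ℤ) (x y : 𝔤) (φ : V) :
    A.quadTerm n m (x ⊗ₜ y) φ =
      if m < 0 then A.J x m (A.J y (n - m) φ) else A.J y (n - m) (A.J x m φ) := by
  rw [quadTerm_tmul, normalOrder]
  split_ifs <;> rfl

/-- The `n`-th mode of the normal ordered quadratic field defined by a tensor. -/
def quad (n : ℤ) (t : 𝔤 ⊗[ℝ] 𝔤) (φ : V) : V := ∑ᶠ m : ℤ, A.quadTerm n m t φ

/-- Normal ordering puts J_{n-m} on the right for m < 0 and J_m for m ≥ 0; either one kills φ once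
|m| is large. -/
theorem support_quadTerm_finite (n : ℤ) (t : 𝔤 ⊗[ℝ] 𝔤) (φ : V) :
    (Function.support fun m => A.quadTerm n m t φ).Finite := by
  obtain ⟨N, hN⟩ := A.exists_forall_J_eq_zero φ
  refine (Set.finite_Icc (min (n - N) 0) (max N 0)).subset fun m hm => ?_
  by_contra hn
  refine hm ?_
  change A.quadTerm n m t φ = 0
  rw [Set.mem_Icc, not_and_or, not_le, not_le] at hn
  clear hm
  induction t using TensorProduct.induction_on with
  | zero => simp
  | add t t' h h' => rw [map_add, LinearMap.add_apply, h, h', add_zero]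
  | tmul x y =>
    rw [quadTerm_tmul_apply]
    rcases hn with hn | hn
    · rw [if_pos (by omega), hN (n - m) (by omega), map_zero]
    · rw [if_neg (by omega), hN m (by omega), map_zero]

theorem quad_add_left (n : ℤ) (t t' : 𝔤 ⊗[ℝ] 𝔤) (φ : V) :
    A.quad n (t + t') φ = A.quad n t φ + A.quad n t' φ := by
  rw [quad, quad, quad, ← finsum_add_distrib (A.support_quadTerm_finite n t φ)
    (A.support_quadTerm_finite n t' φ)]
  exact finsum_congr fun m => by rw [map_add, LinearMap.add_apply]

theorem quad_smul_left (n : ℤ) (r : ℝ) (t : 𝔤 ⊗[ℝ] 𝔤) (φ : V) :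
    A.quad n (r • t) φ = r • A.quad n t φ := by
  rw [quad, quad, smul_finsum]
  exact finsum_congr fun m => by rw [map_smul, LinearMap.smul_apply]

theorem quad_zero_left (n : ℤ) (φ : V) : A.quad n 0 φ = 0 := by
  rw [quad]
  exact finsum_eq_zero_of_forall_eq_zero fun m => by rw [map_zero, LinearMap.zero_apply]

theorem quad_add (n : ℤ) (t : 𝔤 ⊗[ℝ] 𝔤) (φ ψ : V) :
    A.quad n t (φ + ψ) = A.quad n t φ + A.quad n t ψ := by
  rw [quad, quad, quad, ← finsum_add_distrib (A.support_quadTerm_finite n t φ)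
    (A.support_quadTerm_finite n t ψ)]
  exact finsum_congr fun m => by rw [map_add]

theorem quad_smul (n : ℤ) (t : 𝔤 ⊗[ℝ] 𝔤) (c : ℂ) (φ : V) :
    A.quad n t (c • φ) = c • A.quad n t φ := by
  rw [quad, quad, smul_finsum]
  exact finsum_congr fun m => by rw [map_smul]

theorem quad_zero (n : ℤ) (t : 𝔤 ⊗[ℝ] 𝔤) : A.quad n t 0 = 0 := by
  rw [quad]
  exact finsum_eq_zero_of_forall_eq_zero fun m => by rw [map_zero]

/-- The right factor always has nonnegative mode: for m < 0 one has n - m ≥ 0 precisely because n ≥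
-1. -/
theorem quad_vacuum (n : ℤ) (hn : -1 ≤ n) (t : 𝔤 ⊗[ℝ] 𝔤) : A.quad n t A.Ω = 0 := by
  induction t using TensorProduct.induction_on with
  | zero => exact A.quad_zero_left n _
  | add t t' h h' => rw [quad_add_left, h, h', add_zero]
  | tmul x y =>
    rw [quad]
    refine finsum_eq_zero_of_forall_eq_zero fun m => ?_
    rw [quadTerm_tmul_apply]
    split_ifs with hm
    · rw [A.annihilation y (n - m) (by omega), map_zero]
    · rw [A.annihilation x m (by omega), map_zero]

theorem inner_quad (n : ℤ) (t : 𝔤 ⊗[ℝ] 𝔤) (φ ψ : V)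
    (h : ∀ m, inner ℂ ψ (A.quadTerm n m t φ) = 0) : inner ℂ ψ (A.quad n t φ) = 0 := by
  rw [quad, finsum_eq_sum _ (A.support_quadTerm_finite n t φ), inner_sum]
  exact Finset.sum_eq_zero fun m _ => h m

/-- A negative mode of a quadratic field maps into the orthogonal complement of every vector which
is killed by the annihilation operators of the colours involved. -/
theorem inner_quad_tmul_eq_zero (n : ℤ) (hn : n < 0) (x y : 𝔤) (φ ψ : V)
    (hx : ∀ m, 0 < m → A.J x m ψ = 0) (hy : ∀ m, 0 < m → A.J y m ψ = 0) :
    inner ℂ ψ (A.quad n (x ⊗ₜ y) φ) = 0 := by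
  refine A.inner_quad n _ φ ψ fun m => ?_
  have key : ∀ z : 𝔤, (∀ m, 0 < m → A.J z m ψ = 0) → ∀ l < 0, ∀ χ,
      inner ℂ ψ (A.J z l χ) = 0 := by
    intro z hz l hl χ
    have := A.hermitian z (-l) ψ χ
    rw [neg_neg] at this
    rw [← this, hz (-l) (by omega), inner_zero_left]
  rw [quadTerm_tmul_apply]
  split_ifs with hm
  · exact key x hx m hm _
  · exact key y hy (n - m) (by omega) _

theorem inner_vacuum_quad (n : ℤ) (hn : n < 0) (t : 𝔤 ⊗[ℝ] 𝔤) (φ : V) :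
    inner ℂ A.Ω (A.quad n t φ) = 0 := by
  induction t using TensorProduct.induction_on with
  | zero => rw [quad_zero_left, inner_zero_right]
  | add t t' h h' => rw [quad_add_left, inner_add_right, h, h', add_zero]
  | tmul x y =>
    exact A.inner_quad_tmul_eq_zero n hn x y φ _ (fun m hm => A.annihilation _ _ hm.le)
      (fun m hm => A.annihilation _ _ hm.le)

end VacuumCurrents

end Modes

/-! ### Commutators of currents with quadratic fields -/

section Commutator

variable {𝔤 : Type*} [LieRing 𝔤] [LieAlgebra ℝ 𝔤] [FiniteDimensional ℝ 𝔤]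
  [LieAlgebra.IsSimple ℝ 𝔤] {k : ℕ} {V : Type*} [NormedAddCommGroup V] [InnerProductSpace ℂ V]
  (A : VacuumCurrents 𝔤 k V)

/-- The colour of the linear term in the commutator of a current with a quadratic field. -/
def linearPart (k : ℕ) (x : 𝔤) : 𝔤 ⊗[ℝ] 𝔤 →ₗ[ℝ] 𝔤 :=
  TensorProduct.lift (LinearMap.mk₂ ℝ
    (fun a b => ((k : ℝ) * normForm 𝔤 x a) • b + ((k : ℝ) * normForm 𝔤 x b) • a - ⁅⁅x, a⁆, b⁆)
    (fun a a' b => by simp only [map_add, lie_add, add_lie, mul_add, add_smul, smul_add]; abel)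
    (fun c a b => by
      simp only [map_smul, lie_smul, smul_lie, smul_eq_mul, smul_sub, smul_add, smul_smul]
      congr 3 <;> ring)
    (fun a b b' => by simp only [map_add, lie_add, mul_add, add_smul, smul_add]; abel)
    (fun c a b => by
      simp only [map_smul, lie_smul, smul_eq_mul, smul_sub, smul_add, smul_smul]
      congr 3 <;> ring))

theorem linearPart_tmul (k : ℕ) (x a b : 𝔤) : linearPart k x (a ⊗ₜ b) =
    ((k : ℝ) * normForm 𝔤 x a) • b + ((k : ℝ) * normForm 𝔤 x b) • a - ⁅⁅x, a⁆, b⁆ := rfl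

/-- The scalar in the central term of the commutator of a current with a quadratic field. -/
def scalarPart (x : 𝔤) : 𝔤 ⊗[ℝ] 𝔤 →ₗ[ℝ] ℝ :=
  TensorProduct.lift ((normForm 𝔤) ∘ₗ (LieAlgebra.ad ℝ 𝔤 x : 𝔤 →ₗ[ℝ] 𝔤))

theorem scalarPart_tmul (x a b : 𝔤) : scalarPart x (a ⊗ₜ b) = normForm 𝔤 ⁅x, a⁆ b := rfl

/-- Equivariance under the adjoint action, from invariance of the metric and the Jacobi identity. It
keeps the vanishing of all linear parts stable under t ↦ y·t. -/
theorem linearPart_lie (k : ℕ) (x y : 𝔤) (t : 𝔤 ⊗[ℝ] 𝔤) :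
    linearPart k x ⁅y, t⁆ = ⁅y, linearPart k x t⁆ - linearPart k ⁅y, x⁆ t := by
  induction t using TensorProduct.induction_on with
  | zero => simp
  | add t t' h h' => rw [lie_add, map_add, map_add, map_add, lie_add, h, h']; abel
  | tmul a b =>
    rw [TensorProduct.LieModule.lie_tmul_right, map_add, linearPart_tmul, linearPart_tmul,
      linearPart_tmul, linearPart_tmul, normForm_lie_left, normForm_lie_left]
    simp only [lie_add, lie_sub, lie_smul, mul_neg, neg_smul]
    rw [leibniz_lie y ⁅x, a⁆ b, leibniz_lie y x a, add_lie]
    abel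

theorem scalarPart_lie (x y : 𝔤) (t : 𝔤 ⊗[ℝ] 𝔤) :
    scalarPart x ⁅y, t⁆ = - scalarPart ⁅y, x⁆ t := by
  induction t using TensorProduct.induction_on with
  | zero => simp
  | add t t' h h' => rw [lie_add, map_add, map_add, h, h']; abel
  | tmul a b =>
    have h := normForm_lie_left 𝔤 y ⁅x, a⁆ b
    rw [leibniz_lie y x a, map_add, LinearMap.add_apply] at h
    rw [TensorProduct.LieModule.lie_tmul_right, map_add, scalarPart_tmul, scalarPart_tmul,
      scalarPart_tmul]
    linarith

namespace VacuumCurrents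

/-- The difference of the indicator functions of `-p ≤ m` and `0 ≤ m`. -/
def stepDiff (p m : ℤ) : ℤ := (if 0 ≤ m + p then 1 else 0) - (if 0 ≤ m then 1 else 0)

theorem stepDiff_of_nonneg {p : ℤ} (hp : 0 ≤ p) (m : ℤ) :
    stepDiff p m = if m ∈ Finset.Ico (-p) 0 then 1 else 0 := by
  rw [stepDiff]
  simp only [Finset.mem_Ico]
  split_ifs <;> omega

theorem stepDiff_of_neg {p : ℤ} (hp : p < 0) (m : ℤ) :
    stepDiff p m = if m ∈ Finset.Ico 0 (-p) then -1 else 0 := by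
  rw [stepDiff]
  simp only [Finset.mem_Ico]
  split_ifs <;> omega

theorem support_stepDiff (p : ℤ) : (Function.support (stepDiff p)).Finite := by
  refine (Set.finite_Ico (min (-p) 0) (max 0 (-p))).subset fun m hm => ?_
  rw [Function.mem_support, stepDiff] at hm
  rw [Set.mem_Ico]
  split_ifs at hm <;> omega

theorem finsum_stepDiff (p : ℤ) : ∑ᶠ m, stepDiff p m = p := by
  rcases lt_or_ge p 0 with hp | hp
  · rw [finsum_eq_sum_of_support_subset (s := Finset.Ico 0 (-p))]
    · rw [Finset.sum_congr rfl fun m hm => by rw [stepDiff_of_neg hp, if_pos hm]]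
      rw [Finset.sum_const, Int.card_Ico, nsmul_eq_mul]
      simp [hp.le]
    · intro m hm
      rw [Function.mem_support, stepDiff_of_neg hp] at hm
      by_contra h
      exact hm (if_neg h)
  · rw [finsum_eq_sum_of_support_subset (s := Finset.Ico (-p) 0)]
    · rw [Finset.sum_congr rfl fun m hm => by rw [stepDiff_of_nonneg hp, if_pos hm]]
      rw [Finset.sum_const, Int.card_Ico, nsmul_eq_mul]
      simp [hp]
    · intro m hm
      rw [Function.mem_support, stepDiff_of_nonneg hp] at hm
      by_contra h
      exact hm (if_neg h)

/-- The coefficient of the central term in the commutator of the modes `p` and `n` of a current and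
of a quadratic field. -/
def anomaly (k : ℕ) (p n : ℤ) : ℝ := if n + p = 0 then ∑ᶠ m : ℤ, k * (stepDiff p m * (m + p)) else 0

/-- Commuting J^x_p past the factor J^a_m yields mode m + p, still ordered according to the sign of
m. As a term of Q_{n+p} it should be ordered by the sign of m + p; `stepDiff` records where the two
disagree, and reordering there produces the double bracket and the last scalar. -/
theorem J_quadTerm_tmul (x a b : 𝔤) (p n m : ℤ) (φ : V) :
    A.J x p (A.quadTerm n m (a ⊗ₜ b) φ) = A.quadTerm n m (a ⊗ₜ b) (A.J x p φ) +
      Complex.I • A.quadTerm (n + p) m (a ⊗ₜ ⁅x, b⁆) φ +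
      Complex.I • A.quadTerm (n + p) (m + p) (⁅x, a⁆ ⊗ₜ b) φ +
      (if m = n + p then ((k * p * normForm 𝔤 x b : ℝ) : ℂ) • A.J a (n + p) φ else 0) +
      (if m = -p then ((k * p * normForm 𝔤 x a : ℝ) : ℂ) • A.J b (n + p) φ else 0) +
      (stepDiff p m : ℂ) • (-A.J ⁅⁅x, a⁆, b⁆ (n + p) φ) +
      (stepDiff p m * (m + p) * Complex.I *
        (if n + p = 0 then ((k * normForm 𝔤 ⁅x, a⁆ b : ℝ) : ℂ) else 0)) • φ := by
  have hb : central k x b p (n - m) • A.J a m φ =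
      if m = n + p then ((k * p * normForm 𝔤 x b : ℝ) : ℂ) • A.J a (n + p) φ else 0 := by
    rw [central]
    by_cases h : m = n + p
    · rw [if_pos (by omega), if_pos h, h]
    · rw [if_neg (by omega), if_neg h, zero_smul]
  have ha : central k x a p m • A.J b (n - m) φ =
      if m = -p then ((k * p * normForm 𝔤 x a : ℝ) : ℂ) • A.J b (n + p) φ else 0 := by
    rw [central]
    by_cases h : m = -p
    · rw [if_pos (by omega), if_pos h, h, sub_neg_eq_add]
    · rw [if_neg (by omega), if_neg h, zero_smul]
  have hc : A.J ⁅x, a⁆ (m + p) (A.J b (n - m) φ) = A.J b (n - m) (A.J ⁅x, a⁆ (m + p) φ) +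
      Complex.I • A.J ⁅⁅x, a⁆, b⁆ (n + p) φ + ((m + p) *
        (if n + p = 0 then ((k * normForm 𝔤 ⁅x, a⁆ b : ℝ) : ℂ) else 0)) • φ := by
    rw [J_J, central, show m + p + (n - m) = n + p by ring]
    congr 2
    split_ifs
    · push_cast; ring
    · simp
  have hJ : ∀ χ : V, Complex.I • Complex.I • χ = -χ := fun χ => by
    rw [smul_smul, Complex.I_mul_I, neg_one_smul]
  rw [← ha, ← hb]
  simp only [quadTerm_tmul_apply, show n + p - (m + p) = n - m by ring,
    show n + p - m = p + (n - m) by ring]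
  by_cases hm : m < 0
  · simp only [if_pos hm]
    rw [J_J, J_J A x b, add_comm p m]
    by_cases hmp : m + p < 0
    · have hs : stepDiff p m = 0 := by rw [stepDiff, if_neg (by omega), if_neg (by omega)]; rfl
      simp only [if_pos hmp, hs, Int.cast_zero, zero_smul, zero_mul, add_zero, map_add, map_smul]
      abel
    · have hs : stepDiff p m = 1 := by rw [stepDiff, if_pos (by omega), if_neg (by omega)]; rfl
      simp only [if_neg hmp, hs, Int.cast_one, one_smul, one_mul, map_add, map_smul, hc, smul_add,
        hJ, smul_smul]
      rw [mul_left_comm, mul_assoc]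
      abel
  · simp only [if_neg hm]
    rw [J_J, J_J A x a, add_comm p m]
    by_cases hmp : m + p < 0
    · have hs : stepDiff p m = -1 := by rw [stepDiff, if_neg (by omega), if_pos (by omega)]; rfl
      simp only [if_pos hmp, hs, Int.cast_neg, Int.cast_one, neg_smul, one_smul, neg_mul, one_mul,
        map_add, map_smul, hc, smul_add, hJ, smul_smul]
      rw [mul_left_comm, mul_assoc]
      abel
    · have hs : stepDiff p m = 0 := by rw [stepDiff, if_pos (by omega), if_pos (by omega)]; rfl
      simp only [if_neg hmp, hs, Int.cast_zero, zero_smul, zero_mul, add_zero, map_add, map_smul]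
      abel

/-- Summation over m: the index shift by p is absorbed, each central term occurs for a single m, and
the reordering terms add up to p copies since `stepDiff` has total p. Each of the seven families
must be shown finite before the sum is split. -/
theorem J_quad_tmul (x a b : 𝔤) (p n : ℤ) (φ : V) :
    A.J x p (A.quad n (a ⊗ₜ b) φ) = A.quad n (a ⊗ₜ b) (A.J x p φ) +
      Complex.I • A.quad (n + p) ⁅x, a ⊗ₜ[ℝ] b⁆ φ + (p : ℂ) • A.J (linearPart k x (a ⊗ₜ b)) (n + p) φ +
      (Complex.I * (anomaly k p n * scalarPart x (a ⊗ₜ b) : ℝ)) • φ := by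
  have fin_ite : ∀ (q : ℤ) (χ : V), (Function.support fun m : ℤ => if m = q then χ else 0).Finite :=
    fun q χ => (Set.finite_singleton q).subset fun m hm => by
      by_contra h
      exact hm (if_neg h)
  have fin_step : ∀ F : ℤ → V, (∀ m, stepDiff p m = 0 → F m = 0) → (Function.support F).Finite :=
    fun F hF => (support_stepDiff p).subset fun m hm h => hm (hF m h)
  have fin_smul : ∀ F : ℤ → V, (Function.support F).Finite →
      (Function.support fun m => Complex.I • F m).Finite := fun F hF =>
    hF.subset fun m hm h => hm (by simp only [h, smul_zero])
  have fin_shift : (Function.support fun m =>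
      A.quadTerm (n + p) (m + p) (⁅x, a⁆ ⊗ₜ b) φ).Finite :=
    (A.support_quadTerm_finite (n + p) (⁅x, a⁆ ⊗ₜ b) φ).preimage
      (f := fun m => m + p) (add_left_injective p).injOn
  have e0 : A.J x p (A.quad n (a ⊗ₜ b) φ) = ∑ᶠ m, A.J x p (A.quadTerm n m (a ⊗ₜ b) φ) :=
    (A.J x p).toAddMonoidHom.map_finsum (A.support_quadTerm_finite n (a ⊗ₜ b) φ)
  have f1 := A.support_quadTerm_finite n (a ⊗ₜ b) (A.J x p φ)
  have f2 := fin_smul _ (A.support_quadTerm_finite (n + p) (a ⊗ₜ ⁅x, b⁆) φ)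
  have f3 := fin_smul _ fin_shift
  have f4 := fin_ite (n + p) (((k * p * normForm 𝔤 x b : ℝ) : ℂ) • A.J a (n + p) φ)
  have f5 := fin_ite (-p) (((k * p * normForm 𝔤 x a : ℝ) : ℂ) • A.J b (n + p) φ)
  have f6 := fin_step (fun m => (stepDiff p m : ℂ) • (-A.J ⁅⁅x, a⁆, b⁆ (n + p) φ))
    (fun m hm => by simp [hm])
  have f7 := fin_step (fun m => (stepDiff p m * (m + p) * Complex.I *
        (if n + p = 0 then ((k * normForm 𝔤 ⁅x, a⁆ b : ℝ) : ℂ) else 0)) • φ)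
    (fun m hm => by simp [hm])
  have add_fin : ∀ F G : ℤ → V, (Function.support F).Finite → (Function.support G).Finite →
      (Function.support fun m => F m + G m).Finite := fun F G hF hG =>
    (hF.union hG).subset (Function.support_add F G)
  have g2 := add_fin _ _ f1 f2
  have g3 := add_fin _ _ g2 f3
  have g4 := add_fin _ _ g3 f4
  have g5 := add_fin _ _ g4 f5
  have g6 := add_fin _ _ g5 f6
  rw [e0, finsum_congr fun m => A.J_quadTerm_tmul x a b p n m φ, finsum_add_distrib g6 f7,
    finsum_add_distrib g5 f6, finsum_add_distrib g4 f5, finsum_add_distrib g3 f4,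
    finsum_add_distrib g2 f3, finsum_add_distrib f1 f2]
  have s3 : ∑ᶠ m, Complex.I • A.quadTerm (n + p) (m + p) (⁅x, a⁆ ⊗ₜ b) φ =
      Complex.I • A.quad (n + p) (⁅x, a⁆ ⊗ₜ b) φ := by
    rw [← smul_finsum, quad]
    congr 1
    exact finsum_comp_equiv (Equiv.addRight p) (f := fun m => A.quadTerm (n + p) m (⁅x, a⁆ ⊗ₜ b) φ)
  have s45 : ∀ (q : ℤ) (χ : V), ∑ᶠ m : ℤ, (if m = q then χ else 0) = χ := fun q χ => by
    rw [finsum_eq_single _ q fun m hm => if_neg hm, if_pos rfl]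
  have s6 : ∑ᶠ m, (stepDiff p m : ℂ) • (-A.J ⁅⁅x, a⁆, b⁆ (n + p) φ) =
      (p : ℂ) • (-A.J ⁅⁅x, a⁆, b⁆ (n + p) φ) := by
    have h := (Int.castAddHom ℂ).map_finsum (support_stepDiff p)
    rw [finsum_stepDiff] at h
    rw [← finsum_smul]
    exact congrArg (· • _) h.symm
  have s7 : ∑ᶠ m : ℤ, (stepDiff p m * (m + p) * Complex.I *
        (if n + p = 0 then ((k * normForm 𝔤 ⁅x, a⁆ b : ℝ) : ℂ) else 0)) • φ =
      (Complex.I * (anomaly k p n * normForm 𝔤 ⁅x, a⁆ b : ℝ)) • φ := by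
    by_cases h0 : n + p = 0
    · have h := Complex.ofRealHom.toAddMonoidHom.map_finsum_of_injective Complex.ofReal_injective
        fun m : ℤ => (k * (stepDiff p m * (m + p)) : ℝ)
      have h' : ((∑ᶠ m : ℤ, (k * (stepDiff p m * (m + p)) : ℝ) : ℝ) : ℂ) =
        ∑ᶠ m : ℤ, ((k * (stepDiff p m * (m + p)) : ℝ) : ℂ) := h
      simp only [if_pos h0, anomaly]
      rw [Complex.ofReal_mul (finsum _), h', mul_left_comm, ← smul_smul, finsum_smul]
      refine finsum_congr fun m => ?_
      rw [smul_smul]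
      congr 1
      push_cast
      ring
    · simp only [if_neg h0, anomaly]
      simp
  rw [s3, s45, s45, s6, s7, ← smul_finsum, TensorProduct.LieModule.lie_tmul_right, quad_add_left,
    linearPart_tmul, scalarPart_tmul, sub_eq_add_neg, J_add, J_add, J_smul, J_smul, map_neg A.J]
  simp only [← quad.eq_1, LinearMap.add_apply, LinearMap.smul_apply, Pi.neg_apply, LinearMap.neg_apply, smul_add]
  simp only [← Complex.coe_smul, smul_smul]
  have c1 : ∀ r : ℝ, (p : ℂ) * ((k * r : ℝ) : ℂ) = ((k * p * r : ℝ) : ℂ) := fun r => by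
    push_cast; ring
  rw [c1, c1]
  abel

theorem J_quad (x : 𝔤) (t : 𝔤 ⊗[ℝ] 𝔤) (p n : ℤ) (φ : V) :
    A.J x p (A.quad n t φ) = A.quad n t (A.J x p φ) +
      Complex.I • A.quad (n + p) ⁅x, t⁆ φ + (p : ℂ) • A.J (linearPart k x t) (n + p) φ +
      (Complex.I * (anomaly k p n * scalarPart x t : ℝ)) • φ := by
  induction t using TensorProduct.induction_on with
  | zero => simp [quad_zero_left, J_zero]
  | add t t' h h' =>
    rw [lie_add, map_add (linearPart k x), map_add (scalarPart x), quad_add_left, quad_add_left,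
      quad_add_left, map_add (A.J x p), h, h', J_add, mul_add, Complex.ofReal_add, mul_add,
      add_smul, LinearMap.add_apply, smul_add, smul_add]
    abel
  | tmul a b => exact A.J_quad_tmul x a b p n φ

theorem J_quad_of_scalarPart (x : 𝔤) {t : 𝔤 ⊗[ℝ] 𝔤} (ht : scalarPart x t = 0) (p n : ℤ) (φ : V) :
    A.J x p (A.quad n t φ) = A.quad n t (A.J x p φ) +
      Complex.I • A.quad (n + p) ⁅x, t⁆ φ + (p : ℂ) • A.J (linearPart k x t) (n + p) φ := by
  rw [J_quad, ht]
  simp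

end VacuumCurrents

end Commutator

/-! ### Vanishing criterion and coset positivity -/

section Vanishing

variable {𝔤 : Type*} [LieRing 𝔤] [LieAlgebra ℝ 𝔤] [FiniteDimensional ℝ 𝔤]
  [LieAlgebra.IsSimple ℝ 𝔤] {k : ℕ} {V : Type*} [NormedAddCommGroup V] [InnerProductSpace ℂ V]
  (A : VacuumCurrents 𝔤 k V)

/-- A tensor for which the commutators of currents with the quadratic field have no linear and no
central term. -/
def HasFreeCommutators (k : ℕ) (t : 𝔤 ⊗[ℝ] 𝔤) : Prop :=
  (∀ x, linearPart k x t = 0) ∧ ∀ x, scalarPart x t = 0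

theorem HasFreeCommutators.lie {t : 𝔤 ⊗[ℝ] 𝔤} (ht : HasFreeCommutators k t) (y : 𝔤) :
    HasFreeCommutators k ⁅y, t⁆ :=
  ⟨fun x => by rw [linearPart_lie, ht.1, ht.1, lie_zero, sub_zero],
    fun x => by rw [scalarPart_lie, ht.2, neg_zero]⟩

namespace VacuumCurrents

theorem J_quad_of_hasFreeCommutators {t : 𝔤 ⊗[ℝ] 𝔤} (ht : HasFreeCommutators k t) (x : 𝔤) (p n : ℤ) (φ : V) :
    A.J x p (A.quad n t φ) = A.quad n t (A.J x p φ) + Complex.I • A.quad (n + p) ⁅x, t⁆ φ := by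
  rw [J_quad_of_scalarPart A x (ht.2 x), ht.1, J_zero, LinearMap.zero_apply, smul_zero, add_zero]

/-- For n < -1 the vector Q_n(t)Ω is orthogonal to Ω, and J^x_p with p > 0 sends it to i
Q_{n+p}(x·t)Ω, which is zero by induction; hence it vanishes. The tensor varies in the induction
because t need not be 𝔤-invariant. -/
theorem quad_vacuum_of_hasFreeCommutators (j : ℕ) : ∀ (n : ℤ) (t : 𝔤 ⊗[ℝ] 𝔤), -1 - j ≤ n →
    HasFreeCommutators k t → A.quad n t A.Ω = 0 := by
  induction j with
  | zero => exact fun n t hn _ => A.quad_vacuum n (by simpa using hn) t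
  | succ j ih =>
    intro n t hn ht
    by_cases hn' : -1 ≤ n
    · exact A.quad_vacuum n hn' t
    refine A.eq_zero_of_annihilated ?_ fun x p hp => ?_
    · rw [← inner_conj_symm, A.inner_vacuum_quad n (by omega), map_zero]
    · rw [A.J_quad_of_hasFreeCommutators ht, A.annihilation x p hp.le, quad_zero,
        ih (n + p) _ (by push_cast at hn; omega) (ht.lie x), smul_zero, add_zero]

/-- A quadratic field whose commutators with the currents have no linear and no central term
vanishes. -/
theorem quad_eq_zero_of_hasFreeCommutators {t : 𝔤 ⊗[ℝ] 𝔤} (ht : HasFreeCommutators k t) (n : ℤ) (φ : V) :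
    A.quad n t φ = 0 := by
  -- All such t are quantified inside, since moving J^x_p past Q_n(t) brings in x·t.
  let W : Submodule ℂ V :=
    { carrier := {φ | ∀ (n : ℤ) (t : 𝔤 ⊗[ℝ] 𝔤), HasFreeCommutators k t → A.quad n t φ = 0}
      add_mem' := fun {a b} ha hb n t ht => by rw [quad_add, ha n t ht, hb n t ht, add_zero]
      zero_mem' := fun n t _ => A.quad_zero n t
      smul_mem' := fun c a ha n t ht => by rw [quad_smul, ha n t ht, smul_zero] }
  have hW : W = ⊤ := by
    refine A.cyclic W (fun n t ht => ?_) fun x p φ hφ n t ht => ?_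
    · exact A.quad_vacuum_of_hasFreeCommutators (-n).toNat n t (by omega) ht
    · have h := A.J_quad_of_hasFreeCommutators ht x p n φ
      rw [hφ n t ht, hφ (n + p) _ (ht.lie x), map_zero, smul_zero, add_zero] at h
      exact h.symm
  exact (hW ▸ Submodule.mem_top : φ ∈ W) n t ht

/-- Move J^x_{-1} past Q_0(t): both Q_0 and Q_{-1} kill Ω, so only the linear term survives. Thus
Q_0(t) acts on energy one through x ↦ L_x t. -/
theorem quad_zero_creation_vacuum {t : 𝔤 ⊗[ℝ] 𝔤} (x : 𝔤) (ht : scalarPart x t = 0) :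
    A.quad 0 t (A.J x (-1) A.Ω) = A.J (linearPart k x t) (-1) A.Ω := by
  have h := A.J_quad_of_scalarPart x ht (-1) 0 A.Ω
  rw [A.quad_vacuum 0 (by norm_num), A.quad_vacuum (0 + -1) (by norm_num), map_zero] at h
  simp only [smul_zero, add_zero, zero_add, Int.cast_neg, Int.cast_one, neg_smul, one_smul] at h
  exact (eq_of_sub_eq_zero ((sub_eq_add_neg _ _).trans h.symm))

/-- The quadratic field of a tensor vanishes if and only if its commutators with the currents have
no linear term. -/
theorem quad_eq_zero_iff (hk : 0 < k) (hm : IsMetric (normForm 𝔤)) {t : 𝔤 ⊗[ℝ] 𝔤}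
    (ht : ∀ x, scalarPart x t = 0) :
    (∀ n φ, A.quad n t φ = 0) ↔ ∀ x, linearPart k x t = 0 := by
  refine ⟨fun h x => ?_, fun h n φ => A.quad_eq_zero_of_hasFreeCommutators ⟨h, ht⟩ n φ⟩
  refine A.eq_zero_of_creation_vacuum hk hm ?_
  rw [← A.quad_zero_creation_vacuum x (ht x), h]

/-- Positivity of the coset stress-energy tensor on the vectors of energy one: `t` is the tensor of
the difference of a stress-energy tensor `s` for all currents and of a quadratic field `r` in the
currents with colours in `U`, which commute with the difference. -/
theorem linearPart_nonneg (A : VacuumCurrents 𝔤 k V) (hk : 0 < k) (hm : IsMetric (normForm 𝔤)) (U : Set 𝔤)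
    {r s t : 𝔤 ⊗[ℝ] 𝔤} (hst : s = t + r)
    (hr : r ∈ Submodule.span ℝ {w | ∃ u ∈ U, ∃ u' ∈ U, w = u ⊗ₜ[ℝ] u'})
    (hs : ∀ x : 𝔤, ⁅x, s⁆ = 0) (hs₁ : ∀ x, linearPart k x s = x) (hs₂ : ∀ x, scalarPart x s = 0)
    (htU : ∀ u ∈ U, ⁅u, t⁆ = 0 ∧ linearPart k u t = 0) (ht : ∀ x, scalarPart x t = 0) (x : 𝔤) :
    0 ≤ normForm 𝔤 x (linearPart k x t) := by
  set φ := A.J x (-1) A.Ω with hφ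
  set ψ := A.quad (-1) t φ with hψ
  -- J^u_p commutes with Q_{-1}(t) and sends φ to a multiple of Ω, which Q_{-1}(t) kills.
  have hU : ∀ u ∈ U, ∀ p, 0 < p → A.J u p ψ = 0 := by
    intro u hu p hp
    rw [hψ, A.J_quad_of_scalarPart u (ht u), (htU u hu).1, (htU u hu).2, J_zero, quad_zero_left,
      hφ, A.J_creation_vacuum u x p hp, quad_smul, A.quad_vacuum (-1) le_rfl]
    simp
  have hrψ : ∀ w ∈ Submodule.span ℝ {w | ∃ u ∈ U, ∃ u' ∈ U, w = u ⊗ₜ[ℝ] u'},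
      inner ℂ ψ (A.quad (-1) w φ) = 0 := by
    intro w hw
    induction hw using Submodule.span_induction with
    | mem w h =>
      obtain ⟨u, hu, u', hu', rfl⟩ := h
      exact A.inner_quad_tmul_eq_zero (-1) (by norm_num) u u' φ ψ (hU u hu) (hU u' hu')
    | zero => rw [quad_zero_left, inner_zero_right]
    | add a b _ _ ha hb => rw [quad_add_left, inner_add_right, ha, hb, add_zero]
    | smul c a _ ha =>
      rw [quad_smul_left, ← Complex.coe_smul, inner_smul_right, ha, mul_zero]
  -- The translation property of a stress-energy tensor, read off from moving J^x_{-1} past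
  -- Q_{-1}(s) on Ω.
  have hsφ : A.quad (-1) s φ = A.J x (-2) A.Ω := by
    have h := A.J_quad_of_scalarPart x (hs₂ x) (-1) (-1) A.Ω
    rw [A.quad_vacuum (-1) le_rfl, hs, hs₁, quad_zero_left, map_zero] at h
    simp only [smul_zero, add_zero, Int.cast_neg, Int.cast_one, neg_smul, one_smul] at h
    exact (eq_of_sub_eq_zero ((sub_eq_add_neg _ _).trans h.symm))
  -- Although x·t need not vanish, moving J^x_{-1} past Q_1(x·t) leaves only nonnegative current
  -- modes and Q_0, Q_1 acting on Ω.
  have hxt : A.quad 1 ⁅x, t⁆ φ = 0 := by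
    have h0 : scalarPart x ⁅x, t⁆ = 0 := by rw [scalarPart_lie, lie_self, ht, neg_zero]
    have h := A.J_quad_of_scalarPart x h0 (-1) 1 A.Ω
    rw [A.quad_vacuum 1 (by norm_num), A.quad_vacuum (1 + -1) (by norm_num), map_zero,
      A.annihilation _ (1 + -1) (by norm_num)] at h
    simpa using h.symm
  have h2 : A.J x 2 φ = 0 := by
    rw [hφ, A.J_creation_vacuum x x 2 (by norm_num), central, if_neg (by norm_num), zero_smul]
  have h3 : A.J x 2 ψ = ((2 * (k * normForm 𝔤 (linearPart k x t) x) : ℝ) : ℂ) • A.Ω := by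
    rw [hψ, A.J_quad_of_scalarPart x (ht x), h2, quad_zero,
      show (-1 + 2 : ℤ) = 1 by norm_num, hxt, hφ, A.J_one_creation_vacuum, smul_smul]
    simp
  -- Only the second ψ is expanded as Q_{-1}(s)φ - Q_{-1}(r)φ; the r part is orthogonal to ψ, and
  -- hermiticity of the currents moves J^x_{-2} to the left as J^x_2.
  have h4 : inner ℂ ψ ψ = ((2 * (k * normForm 𝔤 (linearPart k x t) x) : ℝ) : ℂ) := by
    have h5 : ψ = A.quad (-1) s φ - A.quad (-1) r φ := by
      rw [hst, quad_add_left, add_sub_cancel_right]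
    calc inner ℂ ψ ψ = inner ℂ ψ (A.quad (-1) s φ) - inner ℂ ψ (A.quad (-1) r φ) := by
          rw [← inner_sub_right, ← h5]
      _ = inner ℂ (A.J x 2 ψ) A.Ω := by rw [hrψ r hr, sub_zero, hsφ, A.hermitian]
      _ = _ := by
        rw [h3, inner_smul_left, Complex.conj_ofReal, inner_self_eq_norm_sq_to_K, A.norm_vacuum]
        simp
  have h6 : (0 : ℝ) ≤ 2 * (k * normForm 𝔤 (linearPart k x t) x) := by
    have h7 := inner_self_nonneg (𝕜 := ℂ) (x := ψ)
    rw [h4] at h7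
    simpa using h7
  have hk' : (0 : ℝ) < k := by exact_mod_cast hk
  rw [hm.symm]
  by_contra hneg
  nlinarith [mul_pos hk' (neg_pos.mpr (not_le.mp hneg))]

end VacuumCurrents

end Vanishing

/-! ### Casimir tensors and normalised embeddings -/

section Tensors

variable {𝔤 E : Type*} [LieRing 𝔤] [LieAlgebra ℝ 𝔤] [AddCommGroup E] [Module ℝ E]
  [FiniteDimensional ℝ E] {τ : E →ₗ[ℝ] 𝔤} {B : LinearMap.BilinForm ℝ E}

/-- The image in `𝔤 ⊗ 𝔤` of the inverse of the metric `B`. -/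
def casimirTensor (τ : E →ₗ[ℝ] 𝔤) (B : LinearMap.BilinForm ℝ E) : 𝔤 ⊗[ℝ] 𝔤 :=
  contract B fun a b => τ a ⊗ₜ τ b

theorem casimirTensor_eq_sum {n : Type*} [Fintype n] [DecidableEq n] {e : Module.Basis n ℝ E}
    (he : IsOrthonormal B e) : casimirTensor τ B = ∑ i, τ (e i) ⊗ₜ τ (e i) :=
  contract_eq_sum he ((TensorProduct.mk ℝ 𝔤 𝔤).compl₁₂ τ τ)

/-- Here ad x acts on the colours through a B-skew map d, and such maps preserve the inverse metric.
-/
theorem lie_casimirTensor (hB : IsMetric B) (x : 𝔤) (d : Module.End ℝ E)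
    (hd : ∀ a b, B (d a) b = -B a (d b)) (hx : ∀ a, ⁅x, τ a⁆ = τ (d a)) :
    ⁅x, casimirTensor τ B⁆ = 0 := by
  obtain ⟨e, he⟩ := hB.exists_orthonormal
  rw [casimirTensor_eq_sum he, lie_sum]
  simp only [TensorProduct.LieModule.lie_tmul_right, hx]
  exact he.sum_skew hB d hd ((TensorProduct.mk ℝ 𝔤 𝔤).compl₁₂ τ τ)

variable [FiniteDimensional ℝ 𝔤] [LieAlgebra.IsSimple ℝ 𝔤] {k : ℕ} {V : Type*}
  [NormedAddCommGroup V] [InnerProductSpace ℂ V] (A : VacuumCurrents 𝔤 k V)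

theorem sugawara_eq_quad (N : ℝ) (n : ℤ) (φ : V) :
    sugawara A τ B N n φ = A.quad n ((1 / (2 * N)) • casimirTensor τ B) φ := by
  rw [A.quad_smul_left, sugawara, VacuumCurrents.quad]
  congr 1
  refine finsum_congr fun m => ?_
  rw [casimirTensor, map_contract]
  rfl

theorem linearPart_casimirTensor {n : Type*} [Fintype n] [DecidableEq n] {e : Module.Basis n ℝ E}
    (he : IsOrthonormal B e) (x : 𝔤) : linearPart k x (casimirTensor τ B) =
      ∑ i, ((2 * k * normForm 𝔤 x (τ (e i))) • τ (e i) - ⁅τ (e i), ⁅τ (e i), x⁆⁆) := by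
  rw [casimirTensor_eq_sum he, map_sum]
  refine Finset.sum_congr rfl fun i _ => ?_
  rw [linearPart_tmul, ← add_smul, ← lie_skew x (τ (e i)), neg_lie, lie_skew]
  congr 2
  ring

/-- The form ([x, ·], ·) is antisymmetric and the tensor symmetric. This is why the sum in `anomaly`
never has to be evaluated. -/
theorem scalarPart_casimirTensor (hm : IsMetric (normForm 𝔤)) (hB : IsMetric B) (x : 𝔤) :
    scalarPart x (casimirTensor τ B) = 0 := by
  obtain ⟨e, he⟩ := hB.exists_orthonormal
  rw [casimirTensor_eq_sum he, map_sum]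
  refine Finset.sum_eq_zero fun i _ => ?_
  have := normForm_lie_left 𝔤 x (τ (e i)) (τ (e i))
  rw [scalarPart_tmul]
  rw [hm.symm (τ (e i))] at this
  linarith

theorem linearPart_casimirTensor_symm (hm : IsMetric (normForm 𝔤)) (hB : IsMetric B) (x y : 𝔤) :
    normForm 𝔤 (linearPart k x (casimirTensor τ B)) y =
      normForm 𝔤 x (linearPart k y (casimirTensor τ B)) := by
  obtain ⟨e, he⟩ := hB.exists_orthonormal
  rw [linearPart_casimirTensor he, linearPart_casimirTensor he, map_sum, map_sum,
    LinearMap.sum_apply]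
  refine Finset.sum_congr rfl fun i _ => ?_
  have h := normForm_lie_left 𝔤 (τ (e i)) x ⁅τ (e i), y⁆
  simp only [map_sub, map_smul, LinearMap.sub_apply, LinearMap.smul_apply, smul_eq_mul]
  rw [normForm_lie_left, h, hm.symm y]
  ring

/-- The normalisation conditions for the embedding `τ` of a summand with metric `B`, Dynkin index
`I` and dual Coxeter number `v`. -/
structure IsNormalised (τ : E →ₗ[ℝ] 𝔤) (B : LinearMap.BilinForm ℝ E) (I v : ℝ) : Prop where
  metric : IsMetric B
  index_pos : 0 < I
  coxeter_nonneg : 0 ≤ v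
  form : ∀ x y, normForm 𝔤 (τ x) (τ y) = I * B x y
  casimir : ∀ {n : Type} [Fintype n] [DecidableEq n] (e : Module.Basis n ℝ E),
    IsOrthonormal B e → ∀ x, ∑ i, ⁅τ (e i), ⁅τ (e i), τ x⁆⁆ = -(2 * v) • τ x

variable {I v : ℝ}

/-- The central terms contribute 2Ik and the Casimir 2v; the Sugawara prefactor is the inverse of
the total. -/
theorem IsNormalised.linearPart_apply (h : IsNormalised τ B I v) (y : E) :
    linearPart k (τ y) (casimirTensor τ B) = (2 * (I * k + v)) • τ y := by
  obtain ⟨e, he⟩ := h.metric.exists_orthonormal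
  rw [linearPart_casimirTensor he, Finset.sum_sub_distrib, h.casimir e he]
  have h1 : ∑ i, (2 * k * normForm 𝔤 (τ y) (τ (e i))) • τ (e i) = (2 * k * I) • τ y := by
    conv_rhs => rw [← he.sum_smul y]
    rw [map_sum, Finset.smul_sum]
    refine Finset.sum_congr rfl fun i _ => ?_
    rw [h.form, h.metric.symm, map_smul, smul_smul]
    congr 1
    ring
  rw [h1, ← sub_smul]
  congr 1
  ring

theorem isNormalised_id (h : ∀ x : 𝔤, x ≠ 0 → killingForm ℝ 𝔤 x x < 0) :
    IsNormalised LinearMap.id (normForm 𝔤) 1 (dualCoxeter 𝔤) where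
  metric := isMetric_normForm 𝔤 h
  index_pos := one_pos
  coxeter_nonneg := (dualCoxeter_pos 𝔤).le
  form x y := by rw [one_mul]; rfl
  casimir e he x := sum_lie_lie_orthonormal 𝔤 h he x

end Tensors

/-! ### The summands of the reductive subalgebra -/

section Summands

variable {𝔤 𝔥 σ : Type*} [LieRing 𝔤] [LieAlgebra ℝ 𝔤] [LieRing 𝔥] [LieAlgebra ℝ 𝔥]
  (ι : 𝔥 →ₗ⁅ℝ⁆ 𝔤) (D : ReductiveDecomposition 𝔥 σ)

theorem embed_apply (α : Option σ) (x : D.ideal α) : embed ι D α x = ι x := rfl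

theorem lie_embed (α : Option σ) (h : 𝔥) (x : D.ideal α) :
    ⁅ι h, embed ι D α x⁆ = embed ι D α ⁅h, x⁆ := by
  rw [embed_apply, embed_apply, ← LieHom.map_lie, LieSubmodule.coe_bracket]

theorem lie_embed_embed (α : Option σ) (x y : D.ideal α) :
    ⁅embed ι D α x, embed ι D α y⁆ = embed ι D α ⁅x, y⁆ := by
  rw [embed_apply, embed_apply, embed_apply, ← LieHom.map_lie]
  rfl

theorem lie_embed_of_ne {α β : Option σ} (hαβ : α ≠ β) (x : D.ideal α) (y : D.ideal β) :
    ⁅embed ι D α x, embed ι D β y⁆ = 0 := by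
  have hd : Disjoint (D.ideal α) (D.ideal β) := D.independent.pairwiseDisjoint hαβ
  have h : ⁅(x : 𝔥), (y : 𝔥)⁆ ∈ D.ideal α ⊓ D.ideal β :=
    ⟨lie_mem_left ℝ 𝔥 (D.ideal α) x y x.2, lie_mem_right ℝ 𝔥 (D.ideal β) x y y.2⟩
  rw [hd.eq_bot, LieSubmodule.mem_bot] at h
  rw [embed_apply, embed_apply, ← LieHom.map_lie, h, map_zero]

variable [FiniteDimensional ℝ 𝔤] [LieAlgebra.IsSimple ℝ 𝔤]

/-- By invariance and [𝔥_α, 𝔥_β] = 0, every bracket in the simple ideal is orthogonal to y. The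
elements orthogonal to y form an ideal, which is not zero because a simple algebra is not abelian.
-/
theorem normForm_embed_some (a : σ) {β : Option σ}
    (hβ : some a ≠ β) (x : D.ideal (some a)) (y : D.ideal β) :
    normForm 𝔤 (embed ι D (some a) x) (embed ι D β y) = 0 := by
  have hs : LieAlgebra.IsSimple ℝ (D.ideal (some a)) := D.isSimple a
  have key : ∀ z x : D.ideal (some a),
      normForm 𝔤 (embed ι D (some a) ⁅z, x⁆) (embed ι D β y) = 0 := fun z x => by
    rw [← lie_embed_embed, normForm_lie_left, lie_embed_of_ne ι D hβ, map_zero, neg_zero]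
  let I : LieIdeal ℝ (D.ideal (some a)) :=
    { carrier := {x | normForm 𝔤 (embed ι D (some a) x) (embed ι D β y) = 0}
      add_mem' := fun {a b} ha hb => by
        simp only [Set.mem_ofPred_eq] at ha hb ⊢
        rw [map_add, map_add, LinearMap.add_apply, ha, hb, add_zero]
      zero_mem' := by simp
      smul_mem' := fun c x hx => by
        simp only [Set.mem_ofPred_eq] at hx ⊢
        rw [map_smul, map_smul, LinearMap.smul_apply, hx, smul_zero]
      lie_mem := fun {z x} _ => key z x }
  rcases LieAlgebra.IsSimple.eq_bot_or_eq_top I with h | h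
  · refine absurd ⟨fun z x => ?_⟩ (LieAlgebra.IsSimple.non_abelian (R := ℝ) (L := D.ideal (some a)))
    have : ⁅z, x⁆ ∈ I := key z x
    rwa [h, LieSubmodule.mem_bot] at this
  · exact (h ▸ LieSubmodule.mem_top x : x ∈ I)

theorem normForm_embed_of_ne (hm : IsMetric (normForm 𝔤)) {α β : Option σ} (hαβ : α ≠ β)
    (x : D.ideal α) (y : D.ideal β) :
    normForm 𝔤 (embed ι D α x) (embed ι D β y) = 0 := by
  match α, β, hαβ, x, y with
  | some a, β, h, x, y => exact normForm_embed_some ι D a h x y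
  | none, some b, h, x, y =>
    rw [hm.symm]
    exact normForm_embed_some ι D b h.symm y x
  | none, none, h, _, _ => exact absurd rfl h

variable {ι}

theorem isMetric_comp_embed (hm : IsMetric (normForm 𝔤)) (hι : Function.Injective ι)
    (α : Option σ) : IsMetric ((normForm 𝔤).comp (embed ι D α) (embed ι D α)) where
  symm x y := hm.symm _ _
  pos x hx := hm.pos _ fun h => hx (Subtype.ext (hι (by rw [← embed_apply, h]; simp)))

theorem comp_embed_lie (α : Option σ) (x y z : D.ideal α) :
    (normForm 𝔤).comp (embed ι D α) (embed ι D α) ⁅x, y⁆ z =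
      -(normForm 𝔤).comp (embed ι D α) (embed ι D α) y ⁅x, z⁆ := by
  simp only [LinearMap.BilinForm.comp_apply, ← lie_embed_embed, normForm_lie_left]

variable [FiniteDimensional ℝ 𝔥]

/-- The metric of 𝔤 pulls back to an invariant metric, so the ideal is itself compact. Uniqueness of
invariant forms then shows that a Dynkin index exists, so that the choice in `dynkinIndex` is
meaningful. -/
theorem isNormalised_some (hm : IsMetric (normForm 𝔤)) (hι : Function.Injective ι) (a : σ) :
    IsNormalised (embed ι D (some a)) (metric ι D (some a)) (dynkinIndex ι D (some a))
      (coxeter D (some a)) := by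
  have hs : LieAlgebra.IsSimple ℝ (D.ideal (some a)) := D.isSimple a
  have hS := isMetric_comp_embed D hm hι (some a)
  have hneg := killingForm_neg_of_invariant _ hS (comp_embed_lie D (some a))
  have hB : IsMetric (normForm (D.ideal (some a))) := isMetric_normForm _ hneg
  obtain ⟨c, hc⟩ := exists_eq_mul_of_invariant _ hB (normForm_lie_left _) hS.symm
    (comp_embed_lie D (some a))
  have hex : ∃ I : ℝ, ∀ x y : D.ideal (some a),
      normForm 𝔤 (embed ι D (some a) x) (embed ι D (some a) y) = I * metric ι D (some a) x y :=
    ⟨c, hc⟩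
  have hform : ∀ x y : D.ideal (some a), normForm 𝔤 (embed ι D (some a) x)
      (embed ι D (some a) y) = dynkinIndex ι D (some a) * normForm (D.ideal (some a)) x y :=
    Classical.epsilon_spec hex
  refine ⟨hB, ?_, (dualCoxeter_pos (D.ideal (some a))).le, hform, fun e he x => ?_⟩
  · have := LieAlgebra.IsSimple.nontrivial ℝ (D.ideal (some a))
    obtain ⟨x, hx⟩ := exists_ne (0 : D.ideal (some a))
    have h1 : 0 < normForm 𝔤 (embed ι D (some a) x) (embed ι D (some a) x) := hS.pos x hx
    rw [hform] at h1
    exact pos_of_mul_pos_left h1 (hB.pos x hx).le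
  · simp only [lie_embed_embed, ← map_sum]
    rw [sum_lie_lie_orthonormal _ hneg he, map_smul]
    rfl

theorem isNormalised_none (hm : IsMetric (normForm 𝔤)) (hι : Function.Injective ι) :
    IsNormalised (embed ι D none) (metric ι D none) (dynkinIndex ι D none) (coxeter D none) where
  metric := isMetric_comp_embed D hm hι none
  index_pos := one_pos
  coxeter_nonneg := le_rfl
  form x y := (one_mul _).symm
  casimir e _ x := by
    have hab : IsLieAbelian (D.ideal none) := D.isLieAbelian
    simp only [lie_embed_embed, trivial_lie_zero, map_zero]
    simp [coxeter]

theorem isNormalised_embed (hm : IsMetric (normForm 𝔤)) (hι : Function.Injective ι) :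
    ∀ α : Option σ, IsNormalised (embed ι D α) (metric ι D α) (dynkinIndex ι D α) (coxeter D α)
  | none => isNormalised_none D hm hι
  | some a => isNormalised_some D hm hι a

end Summands

/-! ### The weighted Casimir as a linear part -/

section WeightedCasimir

variable {𝔤 𝔥 σ : Type*} [LieRing 𝔤] [LieAlgebra ℝ 𝔤] [FiniteDimensional ℝ 𝔤]
  [LieAlgebra.IsSimple ℝ 𝔤] [LieRing 𝔥] [LieAlgebra ℝ 𝔥] [FiniteDimensional ℝ 𝔥]
  {ι : 𝔥 →ₗ⁅ℝ⁆ 𝔤} (D : ReductiveDecomposition 𝔥 σ) {k : ℕ}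

theorem linearPart_casimirTensor_embed (hm : IsMetric (normForm 𝔤)) (hι : Function.Injective ι)
    (α : Option σ) (x : 𝔤) :
    linearPart k x (casimirTensor (embed ι D α) (metric ι D α)) =
      ((2 * dynkinIndex ι D α * k) • proj ι D α + casimir ι D α) x := by
  have h := isNormalised_embed D hm hι α
  set τ := embed ι D α
  obtain ⟨e, he⟩ := h.metric.exists_orthonormal
  have h1 : proj ι D α x = (dynkinIndex ι D α)⁻¹ • ∑ i, normForm 𝔤 (τ (e i)) x • τ (e i) := by
    -- `proj` contracts with the pulled back metric, so it carries I_α⁻¹ relative to a basis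
    -- orthonormal for the metric of the summand. This cancels the I_α in 2 I_α k P_α.
    have he' : ∀ i j, (normForm 𝔤).comp τ τ (e i) (e j) =
        if i = j then dynkinIndex ι D α else 0 := fun i j => by
      rw [LinearMap.BilinForm.comp_apply, h.form, he i j]
      split_ifs <;> simp
    refine (map_contract _ (LinearMap.applyₗ x) _).trans ?_
    exact contract_eq_inv_smul_sum h.index_pos.ne' he'
      (LinearMap.mk₂ ℝ (fun a b => normForm 𝔤 (τ b) x • τ a)
        (fun _ _ _ => by rw [map_add, smul_add])
        (fun _ _ _ => by rw [map_smul, smul_comm])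
        (fun _ _ _ => by rw [map_add, map_add, LinearMap.add_apply, add_smul])
        (fun _ _ _ => by rw [map_smul, map_smul, LinearMap.smul_apply, smul_assoc]))
  have h2 : casimir ι D α x = ∑ i, -⁅τ (e i), ⁅τ (e i), x⁆⁆ := by
    refine (map_contract _ (LinearMap.applyₗ x) _).trans ?_
    exact contract_eq_sum he (LinearMap.mk₂ ℝ (fun a b => -⁅τ a, ⁅τ b, x⁆⁆)
      (fun _ _ _ => by rw [map_add, add_lie, neg_add])
      (fun _ _ _ => by rw [map_smul, smul_lie, smul_neg])
      (fun _ _ _ => by rw [map_add, add_lie, lie_add, neg_add])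
      (fun _ _ _ => by rw [map_smul, smul_lie, lie_smul, smul_neg]))
  rw [LinearMap.add_apply, LinearMap.smul_apply, h1, h2, linearPart_casimirTensor he, smul_smul,
    Finset.smul_sum, ← Finset.sum_add_distrib]
  refine Finset.sum_congr rfl fun i _ => ?_
  rw [smul_smul, hm.symm x, sub_eq_add_neg]
  congr 2
  have := h.index_pos.ne'
  field_simp

variable [Fintype σ]

/-- The tensor of the stress-energy tensor `Θ^𝔥`. -/
def tensorH (ι : 𝔥 →ₗ⁅ℝ⁆ 𝔤) (k : ℕ) : 𝔤 ⊗[ℝ] 𝔤 :=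
  ∑ α : Option σ, (1 / (2 * (dynkinIndex ι D α * k + coxeter D α))) •
    casimirTensor (embed ι D α) (metric ι D α)

/-- The tensor of the stress-energy tensor `Θ^𝔤`. -/
def tensorG (𝔤 : Type*) [LieRing 𝔤] [LieAlgebra ℝ 𝔤] [FiniteDimensional ℝ 𝔤]
    [LieAlgebra.IsSimple ℝ 𝔤] (k : ℕ) : 𝔤 ⊗[ℝ] 𝔤 :=
  (1 / (2 * (k + dualCoxeter 𝔤))) • casimirTensor LinearMap.id (normForm 𝔤)

theorem linearPart_tensorH (hm : IsMetric (normForm 𝔤)) (hι : Function.Injective ι) (x : 𝔤) :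
    linearPart k x (tensorH D ι k) = weightedCasimir ι D k x := by
  rw [tensorH, weightedCasimir, map_sum, LinearMap.sum_apply]
  refine Finset.sum_congr rfl fun α _ => ?_
  rw [map_smul, linearPart_casimirTensor_embed D hm hι, LinearMap.smul_apply]

theorem scalarPart_tensorH (hm : IsMetric (normForm 𝔤)) (hι : Function.Injective ι) (x : 𝔤) :
    scalarPart x (tensorH D ι k) = 0 := by
  rw [tensorH, map_sum]
  refine Finset.sum_eq_zero fun α _ => ?_
  rw [map_smul, scalarPart_casimirTensor hm (isNormalised_embed D hm hι α).metric, smul_zero]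

theorem weightedCasimir_symm (hm : IsMetric (normForm 𝔤)) (hι : Function.Injective ι) (x y : 𝔤) :
    normForm 𝔤 (weightedCasimir ι D k x) y = normForm 𝔤 x (weightedCasimir ι D k y) := by
  rw [← linearPart_tensorH D hm hι, ← linearPart_tensorH D hm hι, tensorH, map_sum, map_sum,
    map_sum, map_sum, LinearMap.sum_apply]
  refine Finset.sum_congr rfl fun α _ => ?_
  rw [map_smul, map_smul, map_smul, map_smul, LinearMap.smul_apply,
    linearPart_casimirTensor_symm hm (isNormalised_embed D hm hι α).metric]

/-- Each ideal is stable under 𝔥, which acts skewly on its metric: invariance holds in 𝔤 and I_α > 0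
can be cancelled. -/
theorem lie_embed_tensorH (hm : IsMetric (normForm 𝔤)) (hι : Function.Injective ι)
    (h : 𝔥) : ⁅ι h, tensorH D ι k⁆ = 0 := by
  rw [tensorH, lie_sum]
  refine Finset.sum_eq_zero fun α _ => ?_
  have hα := isNormalised_embed D hm hι α
  rw [lie_smul, lie_casimirTensor hα.metric (ι h) (LieModule.toEnd ℝ 𝔥 (D.ideal α) h) ?_ ?_,
    smul_zero]
  · intro a b
    refine mul_left_cancel₀ hα.index_pos.ne' ?_
    rw [mul_neg, ← hα.form, ← hα.form, LieModule.toEnd_apply_apply, LieModule.toEnd_apply_apply,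
      ← lie_embed, ← lie_embed, normForm_lie_left]
  · exact fun a => lie_embed ι D α h a

/-- Summands other than β drop out, being orthogonal to and commuting with 𝔥_β. With invariance
under 𝔥 this shows that the currents of 𝔥 commute with Θ^𝔤 - Θ^𝔥. -/
theorem linearPart_embed_tensorH (hm : IsMetric (normForm 𝔤)) (hι : Function.Injective ι)
    (hk : 0 < k) (β : Option σ) (y : D.ideal β) :
    linearPart k (embed ι D β y) (tensorH D ι k) = embed ι D β y := by
  classical
  have hβ := isNormalised_embed D hm hι β
  rw [tensorH, map_sum, Finset.sum_eq_single β]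
  · have hN : 0 < dynkinIndex ι D β * k + coxeter D β :=
      add_pos_of_pos_of_nonneg (mul_pos hβ.index_pos (Nat.cast_pos.mpr hk)) hβ.coxeter_nonneg
    rw [map_smul, hβ.linearPart_apply, smul_smul, one_div, inv_mul_cancel₀ (by positivity),
      one_smul]
  · intro α _ hαβ
    obtain ⟨e, he⟩ := (isNormalised_embed D hm hι α).metric.exists_orthonormal
    rw [map_smul, linearPart_casimirTensor he, Finset.sum_eq_zero, smul_zero]
    intro i _
    rw [lie_embed_of_ne ι D hαβ, normForm_embed_of_ne ι D hm hαβ.symm]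
    simp
  · exact fun h => absurd (Finset.mem_univ β) h

theorem tensorH_mem_span : tensorH D ι k ∈ Submodule.span ℝ
    {w | ∃ u ∈ {u | ∃ (α : Option σ) (y : D.ideal α), u = embed ι D α y},
      ∃ u' ∈ {u | ∃ (α : Option σ) (y : D.ideal α), u = embed ι D α y}, w = u ⊗ₜ[ℝ] u'} := by
  refine Submodule.sum_mem _ fun α _ => Submodule.smul_mem _ _ ?_
  rw [casimirTensor, contract]
  refine Submodule.sum_mem _ fun a _ => Submodule.sum_mem _ fun b _ => Submodule.smul_mem _ _ ?_
  exact Submodule.subset_span ⟨_, ⟨α, _, rfl⟩, _, ⟨α, _, rfl⟩, rfl⟩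

theorem linearPart_tensorG (hcompact : ∀ x : 𝔤, x ≠ 0 → killingForm ℝ 𝔤 x x < 0) (x : 𝔤) :
    linearPart k x (tensorG 𝔤 k) = x := by
  have h := (isNormalised_id hcompact).linearPart_apply (k := k) x
  have := dualCoxeter_pos 𝔤
  rw [LinearMap.id_apply, one_mul] at h
  rw [tensorG, map_smul, h, smul_smul, one_div, inv_mul_cancel₀ (by positivity), one_smul]

theorem scalarPart_tensorG (hm : IsMetric (normForm 𝔤)) (x : 𝔤) :
    scalarPart x (tensorG 𝔤 k) = 0 := by
  rw [tensorG, map_smul, scalarPart_casimirTensor hm hm, smul_zero]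

theorem lie_tensorG (hm : IsMetric (normForm 𝔤)) (x : 𝔤) : ⁅x, tensorG 𝔤 k⁆ = 0 := by
  rw [tensorG, lie_smul, lie_casimirTensor hm x (LieAlgebra.ad ℝ 𝔤 x)
    (fun a b => normForm_lie_left 𝔤 x a b) (fun a => rfl), smul_zero]

variable {V : Type*} [NormedAddCommGroup V] [InnerProductSpace ℂ V] (A : VacuumCurrents 𝔤 k V)

theorem stressG_eq_quad (n : ℤ) (φ : V) : stressG A n φ = A.quad n (tensorG 𝔤 k) φ :=
  sugawara_eq_quad A _ n φ

theorem stressH_eq_quad (n : ℤ) (φ : V) : stressH A ι D n φ = A.quad n (tensorH D ι k) φ := by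
  have h : ∀ (s : Finset (Option σ)) (f : Option σ → 𝔤 ⊗[ℝ] 𝔤),
      A.quad n (∑ α ∈ s, f α) φ = ∑ α ∈ s, A.quad n (f α) φ := fun s f =>
    map_sum (⟨⟨fun t => A.quad n t φ, A.quad_zero_left n φ⟩,
      fun t t' => A.quad_add_left n t t' φ⟩ : 𝔤 ⊗[ℝ] 𝔤 →+ V) f s
  rw [stressH, tensorH, h, Finset.sum_apply, Finset.sum_apply]
  exact Finset.sum_congr rfl fun α _ => sugawara_eq_quad A _ n φ

end WeightedCasimir

end CurrentAlgebra

end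

open CurrentAlgebra

theorem mainTheorem1 {𝔤 𝔥 σ V : Type*}
    [LieRing 𝔤] [LieAlgebra ℝ 𝔤] [FiniteDimensional ℝ 𝔤] [LieAlgebra.IsSimple ℝ 𝔤]
    (hcompact : ∀ x : 𝔤, x ≠ 0 → killingForm ℝ 𝔤 x x < 0)
    [LieRing 𝔥] [LieAlgebra ℝ 𝔥] [FiniteDimensional ℝ 𝔥]
    [Fintype σ] (D : ReductiveDecomposition 𝔥 σ)
    (ι : 𝔥 →ₗ⁅ℝ⁆ 𝔤) (hι : Function.Injective ι)
    (k : ℕ) (hk : 0 < k)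
    [NormedAddCommGroup V] [InnerProductSpace ℂ V] (A : VacuumCurrents 𝔤 k V) :
    (∀ x y : 𝔤, normForm 𝔤 (weightedCasimir ι D k x) y =
      normForm 𝔤 x (weightedCasimir ι D k y)) ∧
    (∀ x : 𝔤, normForm 𝔤 x (weightedCasimir ι D k x) ≤ normForm 𝔤 x x) ∧
    (weightedCasimir ι D k = 1 ↔ stressH A ι D = stressG A) := by
  have hm := isMetric_normForm 𝔤 hcompact
  have hlin : ∀ x, linearPart k x (tensorG 𝔤 k - tensorH D ι k) = x - weightedCasimir ι D k x :=
    fun x => by rw [map_sub, linearPart_tensorG hcompact, linearPart_tensorH D hm hι]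
  have hscal : ∀ x : 𝔤, scalarPart x (tensorG 𝔤 k - tensorH D ι k) = 0 := fun x => by
    rw [map_sub, scalarPart_tensorG hm, scalarPart_tensorH D hm hι, sub_zero]
  refine ⟨weightedCasimir_symm D hm hι, fun x => ?_, ?_⟩
  -- U is only the union of the images of the ideals, which suffices because the tensor of Θ^𝔥 has
  -- no mixed terms.
  · have h := A.linearPart_nonneg hk hm {u | ∃ (α : Option σ) (y : D.ideal α), u = embed ι D α y}
      (sub_add_cancel _ _).symm (tensorH_mem_span D) (lie_tensorG hm) (linearPart_tensorG hcompact)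
      (scalarPart_tensorG hm) ?_ hscal x
    · rwa [hlin, map_sub, sub_nonneg] at h
    · rintro u ⟨α, y, rfl⟩
      rw [lie_sub, lie_tensorG hm, map_sub, linearPart_tensorG hcompact,
        linearPart_embed_tensorH D hm hι hk, embed_apply, lie_embed_tensorH D hm hι, sub_self,
        sub_self]
      exact ⟨rfl, rfl⟩
  · have hsplit : ∀ n φ, stressG A n φ =
        A.quad n (tensorG 𝔤 k - tensorH D ι k) φ + stressH A ι D n φ := fun n φ => by
      rw [stressG_eq_quad, stressH_eq_quad, ← A.quad_add_left, sub_add_cancel]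
    have h1 : stressH A ι D = stressG A ↔
        ∀ n φ, A.quad n (tensorG 𝔤 k - tensorH D ι k) φ = 0 := by
      simp only [funext_iff, hsplit, right_eq_add]
    rw [h1, A.quad_eq_zero_iff hk hm hscal]
    simp only [hlin, sub_eq_zero, LinearMap.ext_iff, Module.End.one_apply]
    exact forall_congr' fun x => eq_comm
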